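/- **Setting.** Let $\mathcal W$ be the monoidal (pseudo) double category of wiring diagrams. Its objects are boxes, i.e. pairs of sets $(A,B)$ ($A$ the inputs, $B$ the outputs). A vertical arrow $\varphi:(A,B)\to(C,D)$ is a wiring diagram, i.e. a pair of maps $\varphi^{in}:C\times B\to A$, $\varphi^{out}:B\to D$, with composite $(\psi\varphi)^{in}(e,b)=\varphi^{in}(\psi^{in}(e,\varphi^{out}(b)),b)$, $(\psi\varphi)^{out}=\psi^{out}\varphi^{out}$. A horizontal arrow $(A,B)\to(A',B')$ is a pair of maps $f:A\to A'$, $g:B\to B'$; a square from $(f,g)$ to $(f',g')$ with sides $\varphi,\psi$ is the property $\psi^{out}g=g'\varphi^{out}$ and $\psi^{in}(f'(c),g(b))=f(\varphi^{in}(c,b))$. The tensor product is the cartesian product of boxes, with unit $(*,*)$. Let $\mathbf{Prof}$ be the monoidal double category of (small) categories, functors (vertical), profunctors (horizontal, composed by coends) and natural transformations, with cartesian product as tensor product. *Continuous systems.* $\mathrm{CS}(A,B)$ is the category of systems $A\times S\xrightarrow{f^{upd}}S\xrightarrow{f^{rdt}}B$ with $S$ a real vector space (the maps being arbitrary functions).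 For a horizontal arrow $(f,g):(A,B)\to(A',B')$, $\mathrm{CS}(f,g)$ is the profunctor whose elements from a system on $S$ to a system on $T$ are the linear maps $m:S\to T$ with $m\,f_S^{upd}(a,s)=f_T^{upd}(f(a),m s)$ and $f_T^{rdt}(m s)=g(f_S^{rdt}(s))$; the morphisms of $\mathrm{CS}(A,B)$ are the case $f=g=\mathrm{id}$. A wiring diagram $\varphi$ sends a system on $S$ to the system on $S$ with update $(c,s)\mapsto f^{upd}(\varphi^{in}(c,f^{rdt}(s)),s)$ and readout $\varphi^{out}f^{rdt}$, and is the identity on the underlying linear maps. The comparison $\mathrm{CS}(M)\odot\mathrm{CS}(N)\to\mathrm{CS}(M\odot N)$ composes linear maps, the comparison for units is the identity, and the lax monoidal structure is given by the parallel product (state space $S\times T$) and the trivial system on $*$. *Four-step systems.* Let $C_4$ be the discrete system on $(*,*)$ with states $\{1,2,3,4\}$ iterated cyclically. $(\mathrm{DS}/C_4)(A,B)$ is the category of systems $A\times S\to S\to B$ with $S$ a set, equipped with a morphism to $C_4$ (equivalently a decomposition $S=S_1\sqcup S_2\sqcup S_3\sqcup S_4$ with the update sending $S_i$ to $S_{i+1}$,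 indices modulo 4). Morphisms, profunctors $(\mathrm{DS}/C_4)(f,g)$, the action of wiring diagrams and the comparisons are as for $\mathrm{CS}$, with linear maps replaced by maps that preserve the decomposition. The lax monoidal structure is the parallel product over $C_4$, with states $\bigsqcup_{i=1}^4S_i\times T_i$, and its unit is $C_4$. Both $\mathrm{CS}$ and $\mathrm{DS}/C_4$ are lax monoidal double functors $\mathcal W\to\mathbf{Prof}$. Here the laws of a lax double functor and the naturality of the laxity hold on the nose, while the associativity and unit laws of the parallel product of systems hold up to the canonical isomorphisms, such as $(S\times T)\times R\cong S\times(T\times R)$; these are natural in systems, in wiring diagrams and in horizontal arrows, and satisfy the pentagon and triangle identities. *The Runge–Kutta method.* For $h\in\mathbb R$ let $\mathrm{RK}_h(A,B):\mathrm{CS}(A,B)\to(\mathrm{DS}/C_4)(A,B)$ send a system $A\times S\xrightarrow{f^{upd}}S\xrightarrow{f^{rdt}}B$ to the system with states $S\sqcup S^2\sqcup S^3\sqcup S^4$ ($S^i$ lying over $i$), with update $$\begin{aligned}(a,s)&\mapsto(s,f^{upd}(a,s)),\\ (a,s,k_1)&\mapsto(s,k_1,f^{upd}(a,s+\tfrac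 h2k_1)),\\ (a,s,k_1,k_2)&\mapsto(s,k_1,k_2,f^{upd}(a,s+\tfrac h2k_2)),\\ (a,s,k_1,k_2,k_3)&\mapsto s+\tfrac h6k_1+\tfrac h3k_2+\tfrac h3k_3+\tfrac h6f^{upd}(a,s+hk_3),\end{aligned}$$ and readout $f^{rdt}$ evaluated at $s$, $s+\frac h2k_1$, $s+\frac h2k_2$, $s+hk_3$ respectively; and let it send a morphism $m$ over $(f,g)$ (in particular over the identity) to $m\sqcup m^2\sqcup m^3\sqcup m^4$. **Theorem 1.** For every $h\in\mathbb R$, $\mathrm{RK}_h$ is a monoidal double transformation $\mathrm{CS}\Rightarrow\mathrm{DS}/C_4$. That is: 1. The maps $\mathrm{RK}_h(A,B)$ are functors and form a natural transformation in wiring diagrams: $\mathrm{RK}_h(\varphi(X))=\varphi(\mathrm{RK}_h(X))$, and likewise on morphisms. 2. The maps $m\mapsto m\sqcup m^2\sqcup m^3\sqcup m^4$ are squares $\mathrm{CS}(f,g)\to(\mathrm{DS}/C_4)(f,g)$ of profunctors with sides $\mathrm{RK}_h(A,B)$ and $\mathrm{RK}_h(A',B')$, natural in the squares of $\mathcal W$.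 3. They commute with the comparisons for horizontal composition and for horizontal units. 4. They are compatible with parallel products and units through the canonical isomorphisms $\mathrm{RK}_h(X\otimes Y)\cong\mathrm{RK}_h(X)\otimes_{C_4}\mathrm{RK}_h(Y)$, given by the bijections $(S\times T)^i\cong S^i\times T^i$, and $\mathrm{RK}_h(*)\cong C_4$. These isomorphisms are natural in systems, in wiring diagrams and in horizontal arrows, and coherent with the associativity and unit isomorphisms of the two parallel products. -/

import Mathlib

open CategoryTheory MonoidalCategory Opposite

universe w' w v u

set_option linter.checkUnivs false
set_option linter.unusedSimpArgs false
set_option linter.unusedVariables false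

namespace DoubleCat

/-! ## Double categories -/

/-- The data of a (pseudo) double category on a category `D` of objects and vertical arrows.
`Hor A B` is the type of objects `M` of the category of arrows with `L M = A` and `R M = B`, and
`Sq f g M N` is the type of morphisms `M ⟶ N` of the category of arrows that `L` and `R` send
to `f` and `g`. -/
class DoubleData (D : Type u) [Category.{v} D] where
  /-- horizontal arrows -/
  Hor : D → D → Type w
  /-- squares (2-cells) with given left, right, top and bottom sides -/
  Sq : ∀ {A B A' B' : D}, (A ⟶ A') → (B ⟶ B') → Hor A B → Hor A' B' → Type w'
  /-- vertical identity squares -/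
  vid : ∀ {A B : D} (M : Hor A B), Sq (𝟙 A) (𝟙 B) M M
  /-- vertical composition of squares -/
  vcomp : ∀ {A B A' B' A'' B'' : D} {f : A ⟶ A'} {g : B ⟶ B'} {f' : A' ⟶ A''} {g' : B' ⟶ B''}
    {M : Hor A B} {N : Hor A' B'} {P : Hor A'' B''},
    Sq f g M N → Sq f' g' N P → Sq (f ≫ f') (g ≫ g') M P
  /-- the horizontal unit -/
  U : ∀ A : D, Hor A A
  /-- the horizontal unit on vertical arrows -/
  Usq : ∀ {A A' : D} (f : A ⟶ A'), Sq f f (U A) (U A')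
  /-- horizontal composition, in diagrammatic order -/
  hcomp : ∀ {A B C : D}, Hor A B → Hor B C → Hor A C
  /-- horizontal composition of squares -/
  hsq : ∀ {A B C A' B' C' : D} {f : A ⟶ A'} {g : B ⟶ B'} {k : C ⟶ C'}
    {M : Hor A B} {N : Hor B C} {M' : Hor A' B'} {N' : Hor B' C'},
    Sq f g M M' → Sq g k N N' → Sq f k (hcomp M N) (hcomp M' N')
  /-- the associator for horizontal composition, and its inverse -/
  a : ∀ {A B C E : D} (M : Hor A B) (N : Hor B C) (P : Hor C E),
    Sq (𝟙 A) (𝟙 E) (hcomp (hcomp M N) P) (hcomp M (hcomp N P))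
  aInv : ∀ {A B C E : D} (M : Hor A B) (N : Hor B C) (P : Hor C E),
    Sq (𝟙 A) (𝟙 E) (hcomp M (hcomp N P)) (hcomp (hcomp M N) P)
  /-- the left unitor for horizontal composition, and its inverse -/
  l : ∀ {A B : D} (M : Hor A B), Sq (𝟙 A) (𝟙 B) (hcomp (U A) M) M
  lInv : ∀ {A B : D} (M : Hor A B), Sq (𝟙 A) (𝟙 B) M (hcomp (U A) M)
  /-- the right unitor for horizontal composition, and its inverse -/
  r : ∀ {A B : D} (M : Hor A B), Sq (𝟙 A) (𝟙 B) (hcomp M (U B)) M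
  rInv : ∀ {A B : D} (M : Hor A B), Sq (𝟙 A) (𝟙 B) M (hcomp M (U B))

open DoubleData

/-- vertical composition of squares -/
infixr:80 " ≫ᵥ " => DoubleData.vcomp
/-- horizontal composition of horizontal arrows -/
infixr:85 " ⊙ " => DoubleData.hcomp
/-- horizontal composition of squares -/
infixr:85 " ⊙ₛ " => DoubleData.hsq

/-- Equality of squares as morphisms of the category of arrows: the left and right sides agree,
and so do the squares. -/
def SqEq {D : Type u} [Category.{v} D] [DoubleData.{w', w} D] {A B A' B' : D}
    {f f' : A ⟶ A'} {g g' : B ⟶ B'} {M : Hor A B} {N : Hor A' B'}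
    (σ : Sq f g M N) (τ : Sq f' g' M N) : Prop :=
  f = f' ∧ g = g' ∧ HEq σ τ

/-- equality of squares as morphisms of the category of arrows -/
infix:50 " ≡ₛ " => SqEq

/-- A (pseudo) double category. -/
class DoubleCategory (D : Type u) [Category.{v} D] where
  [toData : DoubleData.{w', w} D]
  /- horizontal arrows and squares form a category, over the vertical arrows on both sides -/
  vid_vcomp : ∀ {A B A' B' : D} {f : A ⟶ A'} {g : B ⟶ B'} {M : Hor A B} {N : Hor A' B'}
    (σ : Sq f g M N), vid M ≫ᵥ σ ≡ₛ σ
  vcomp_vid : ∀ {A B A' B' : D} {f : A ⟶ A'} {g : B ⟶ B'} {M : Hor A B} {N : Hor A' B'}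
    (σ : Sq f g M N), σ ≫ᵥ vid N ≡ₛ σ
  vcomp_assoc : ∀ {A B A' B' A'' B'' A₃ B₃ : D} {f : A ⟶ A'} {g : B ⟶ B'} {f' : A' ⟶ A''}
    {g' : B' ⟶ B''} {f'' : A'' ⟶ A₃} {g'' : B'' ⟶ B₃}
    {M : Hor A B} {N : Hor A' B'} {P : Hor A'' B''} {Q : Hor A₃ B₃}
    (σ : Sq f g M N) (τ : Sq f' g' N P) (ρ : Sq f'' g'' P Q),
    (σ ≫ᵥ τ) ≫ᵥ ρ ≡ₛ σ ≫ᵥ (τ ≫ᵥ ρ)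
  /- the horizontal unit is a functor -/
  Usq_id : ∀ A : D, Usq (𝟙 A) = vid (U A)
  Usq_comp : ∀ {A B C : D} (f : A ⟶ B) (g : B ⟶ C), Usq (f ≫ g) = Usq f ≫ᵥ Usq g
  /- horizontal composition is a functor -/
  hsq_vid : ∀ {A B C : D} (M : Hor A B) (N : Hor B C), vid M ⊙ₛ vid N = vid (M ⊙ N)
  hsq_vcomp : ∀ {A B C A' B' C' A'' B'' C'' : D} {f : A ⟶ A'} {g : B ⟶ B'} {k : C ⟶ C'}
    {f' : A' ⟶ A''} {g' : B' ⟶ B''} {k' : C' ⟶ C''}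
    {M : Hor A B} {N : Hor B C} {M' : Hor A' B'} {N' : Hor B' C'} {M'' : Hor A'' B''}
    {N'' : Hor B'' C''} (σ : Sq f g M M') (τ : Sq g k N N') (σ' : Sq f' g' M' M'')
    (τ' : Sq g' k' N' N''),
    (σ ≫ᵥ σ') ⊙ₛ (τ ≫ᵥ τ') = (σ ⊙ₛ τ) ≫ᵥ (σ' ⊙ₛ τ')
  /- the associator and the unitors are natural and invertible -/
  a_natural : ∀ {A B C E A' B' C' E' : D} {f : A ⟶ A'} {g : B ⟶ B'} {k : C ⟶ C'} {m : E ⟶ E'}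
    {M : Hor A B} {N : Hor B C} {P : Hor C E} {M' : Hor A' B'} {N' : Hor B' C'} {P' : Hor C' E'}
    (σ : Sq f g M M') (τ : Sq g k N N') (ρ : Sq k m P P'),
    ((σ ⊙ₛ τ) ⊙ₛ ρ) ≫ᵥ a M' N' P' ≡ₛ a M N P ≫ᵥ (σ ⊙ₛ (τ ⊙ₛ ρ))
  a_aInv : ∀ {A B C E : D} (M : Hor A B) (N : Hor B C) (P : Hor C E),
    a M N P ≫ᵥ aInv M N P ≡ₛ vid ((M ⊙ N) ⊙ P)
  aInv_a : ∀ {A B C E : D} (M : Hor A B) (N : Hor B C) (P : Hor C E),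
    aInv M N P ≫ᵥ a M N P ≡ₛ vid (M ⊙ (N ⊙ P))
  l_natural : ∀ {A B A' B' : D} {f : A ⟶ A'} {g : B ⟶ B'} {M : Hor A B} {N : Hor A' B'}
    (σ : Sq f g M N), (Usq f ⊙ₛ σ) ≫ᵥ l N ≡ₛ l M ≫ᵥ σ
  l_lInv : ∀ {A B : D} (M : Hor A B), l M ≫ᵥ lInv M ≡ₛ vid (U A ⊙ M)
  lInv_l : ∀ {A B : D} (M : Hor A B), lInv M ≫ᵥ l M ≡ₛ vid M
  r_natural : ∀ {A B A' B' : D} {f : A ⟶ A'} {g : B ⟶ B'} {M : Hor A B} {N : Hor A' B'}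
    (σ : Sq f g M N), (σ ⊙ₛ Usq g) ≫ᵥ r N ≡ₛ r M ≫ᵥ σ
  r_rInv : ∀ {A B : D} (M : Hor A B), r M ≫ᵥ rInv M ≡ₛ vid (M ⊙ U B)
  rInv_r : ∀ {A B : D} (M : Hor A B), rInv M ≫ᵥ r M ≡ₛ vid M
  /- coherence -/
  triangle : ∀ {A B C : D} (M : Hor A B) (N : Hor B C),
    a M (U B) N ≫ᵥ (vid M ⊙ₛ l N) ≡ₛ r M ⊙ₛ vid N
  pentagon : ∀ {A B C E F : D} (M : Hor A B) (N : Hor B C) (P : Hor C E) (Q : Hor E F),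
    a (M ⊙ N) P Q ≫ᵥ a M N (P ⊙ Q) ≡ₛ
      (a M N P ⊙ₛ vid Q) ≫ᵥ a M (N ⊙ P) Q ≫ᵥ (vid M ⊙ₛ a N P Q)

attribute [reducible, instance] DoubleCategory.toData

/-! ## Monoidal double categories -/

/-- The data of a monoidal double category whose category of objects is a given monoidal
category; the unit of the category of arrows is `U (𝟙_ D)`. -/
class MonoidalDoubleData (D : Type u) [Category.{v} D] [MonoidalCategory D]
    [DoubleCategory.{w', w} D] where
  /-- tensor product of horizontal arrows -/
  tHor : ∀ {A B A' B' : D}, Hor A B → Hor A' B' → Hor (A ⊗ A') (B ⊗ B')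
  /-- tensor product of squares -/
  tSq : ∀ {A B A' B' C E C' E' : D} {f : A ⟶ C} {g : B ⟶ E} {f' : A' ⟶ C'} {g' : B' ⟶ E'}
    {M : Hor A B} {N : Hor C E} {M' : Hor A' B'} {N' : Hor C' E'},
    Sq f g M N → Sq f' g' M' N' → Sq (f ⊗ₘ f') (g ⊗ₘ g') (tHor M M') (tHor N N')
  /-- associativity constraint of the tensor product of horizontal arrows, and its inverse -/
  ta : ∀ {A B A' B' A'' B'' : D} (M : Hor A B) (N : Hor A' B') (P : Hor A'' B''),
    Sq (α_ A A' A'').hom (α_ B B' B'').hom (tHor (tHor M N) P) (tHor M (tHor N P))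
  taInv : ∀ {A B A' B' A'' B'' : D} (M : Hor A B) (N : Hor A' B') (P : Hor A'' B''),
    Sq (α_ A A' A'').inv (α_ B B' B'').inv (tHor M (tHor N P)) (tHor (tHor M N) P)
  /-- left unit constraint, and its inverse -/
  tl : ∀ {A B : D} (M : Hor A B), Sq (λ_ A).hom (λ_ B).hom (tHor (U (𝟙_ D)) M) M
  tlInv : ∀ {A B : D} (M : Hor A B), Sq (λ_ A).inv (λ_ B).inv M (tHor (U (𝟙_ D)) M)
  /-- right unit constraint, and its inverse -/
  tr : ∀ {A B : D} (M : Hor A B), Sq (ρ_ A).hom (ρ_ B).hom (tHor M (U (𝟙_ D))) M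
  trInv : ∀ {A B : D} (M : Hor A B), Sq (ρ_ A).inv (ρ_ B).inv M (tHor M (U (𝟙_ D)))
  /-- interchange of `⊗` and `⊙`, and its inverse -/
  x : ∀ {A B C A' B' C' : D} (M : Hor A B) (M' : Hor A' B') (N : Hor B C) (N' : Hor B' C'),
    Sq (𝟙 (A ⊗ A')) (𝟙 (C ⊗ C')) (tHor M M' ⊙ tHor N N') (tHor (M ⊙ N) (M' ⊙ N'))
  xInv : ∀ {A B C A' B' C' : D} (M : Hor A B) (M' : Hor A' B') (N : Hor B C) (N' : Hor B' C'),
    Sq (𝟙 (A ⊗ A')) (𝟙 (C ⊗ C')) (tHor (M ⊙ N) (M' ⊙ N')) (tHor M M' ⊙ tHor N N')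
  /-- interchange of `⊗` and `U`, and its inverse -/
  u : ∀ A B : D, Sq (𝟙 (A ⊗ B)) (𝟙 (A ⊗ B)) (U (A ⊗ B)) (tHor (U A) (U B))
  uInv : ∀ A B : D, Sq (𝟙 (A ⊗ B)) (𝟙 (A ⊗ B)) (tHor (U A) (U B)) (U (A ⊗ B))

open MonoidalDoubleData

/-- tensor product of horizontal arrows -/
infixr:90 " ⊠ " => MonoidalDoubleData.tHor
/-- tensor product of squares -/
infixr:90 " ⊠ₛ " => MonoidalDoubleData.tSq

/-- A monoidal double category. -/
class MonoidalDoubleCategory (D : Type u) [Category.{v} D] [MonoidalCategory D]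
    [DoubleCategory.{w', w} D] where
  [toMonoidalData : MonoidalDoubleData.{w', w} D]
  /- the category of arrows is monoidal, strictly over the category of objects -/
  tSq_vid : ∀ {A B A' B' : D} (M : Hor A B) (M' : Hor A' B'), vid M ⊠ₛ vid M' ≡ₛ vid (M ⊠ M')
  tSq_vcomp : ∀ {A B A' B' C E C' E' F G F' G' : D} {f : A ⟶ C} {g : B ⟶ E} {f' : A' ⟶ C'}
    {g' : B' ⟶ E'} {k : C ⟶ F} {m : E ⟶ G} {k' : C' ⟶ F'} {m' : E' ⟶ G'}
    {M : Hor A B} {N : Hor C E} {M' : Hor A' B'} {N' : Hor C' E'} {P : Hor F G} {P' : Hor F' G'}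
    (σ : Sq f g M N) (τ : Sq k m N P) (σ' : Sq f' g' M' N') (τ' : Sq k' m' N' P'),
    (σ ≫ᵥ τ) ⊠ₛ (σ' ≫ᵥ τ') ≡ₛ (σ ⊠ₛ σ') ≫ᵥ (τ ⊠ₛ τ')
  ta_natural : ∀ {A B A' B' A'' B'' C E C' E' C'' E'' : D} {f : A ⟶ C} {g : B ⟶ E} {f' : A' ⟶ C'}
    {g' : B' ⟶ E'} {f'' : A'' ⟶ C''} {g'' : B'' ⟶ E''} {M : Hor A B} {N : Hor C E}
    {M' : Hor A' B'} {N' : Hor C' E'} {M'' : Hor A'' B''} {N'' : Hor C'' E''}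
    (σ : Sq f g M N) (σ' : Sq f' g' M' N') (σ'' : Sq f'' g'' M'' N''),
    ((σ ⊠ₛ σ') ⊠ₛ σ'') ≫ᵥ ta N N' N'' ≡ₛ ta M M' M'' ≫ᵥ (σ ⊠ₛ (σ' ⊠ₛ σ''))
  ta_taInv : ∀ {A B A' B' A'' B'' : D} (M : Hor A B) (N : Hor A' B') (P : Hor A'' B''),
    ta M N P ≫ᵥ taInv M N P ≡ₛ vid ((M ⊠ N) ⊠ P)
  taInv_ta : ∀ {A B A' B' A'' B'' : D} (M : Hor A B) (N : Hor A' B') (P : Hor A'' B''),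
    taInv M N P ≫ᵥ ta M N P ≡ₛ vid (M ⊠ (N ⊠ P))
  tl_natural : ∀ {A B C E : D} {f : A ⟶ C} {g : B ⟶ E} {M : Hor A B} {N : Hor C E}
    (σ : Sq f g M N), (vid (U (𝟙_ D)) ⊠ₛ σ) ≫ᵥ tl N ≡ₛ tl M ≫ᵥ σ
  tl_tlInv : ∀ {A B : D} (M : Hor A B), tl M ≫ᵥ tlInv M ≡ₛ vid (U (𝟙_ D) ⊠ M)
  tlInv_tl : ∀ {A B : D} (M : Hor A B), tlInv M ≫ᵥ tl M ≡ₛ vid M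
  tr_natural : ∀ {A B C E : D} {f : A ⟶ C} {g : B ⟶ E} {M : Hor A B} {N : Hor C E}
    (σ : Sq f g M N), (σ ⊠ₛ vid (U (𝟙_ D))) ≫ᵥ tr N ≡ₛ tr M ≫ᵥ σ
  tr_trInv : ∀ {A B : D} (M : Hor A B), tr M ≫ᵥ trInv M ≡ₛ vid (M ⊠ U (𝟙_ D))
  trInv_tr : ∀ {A B : D} (M : Hor A B), trInv M ≫ᵥ tr M ≡ₛ vid M
  t_triangle : ∀ {A B A' B' : D} (M : Hor A B) (N : Hor A' B'),
    ta M (U (𝟙_ D)) N ≫ᵥ (vid M ⊠ₛ tl N) ≡ₛ tr M ⊠ₛ vid N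
  t_pentagon : ∀ {A B A' B' A'' B'' A₃ B₃ : D} (M : Hor A B) (N : Hor A' B') (P : Hor A'' B'')
    (Q : Hor A₃ B₃),
    ta (M ⊠ N) P Q ≫ᵥ ta M N (P ⊠ Q) ≡ₛ
      (ta M N P ⊠ₛ vid Q) ≫ᵥ ta M (N ⊠ P) Q ≫ᵥ (vid M ⊠ₛ ta N P Q)
  /- the interchange squares are natural and invertible -/
  x_natural : ∀ {A B C A' B' C' E F G E' F' G' : D} {f : A ⟶ E} {g : B ⟶ F} {k : C ⟶ G}
    {f' : A' ⟶ E'} {g' : B' ⟶ F'} {k' : C' ⟶ G'} {M : Hor A B} {M' : Hor A' B'} {N : Hor B C}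
    {N' : Hor B' C'} {P : Hor E F} {P' : Hor E' F'} {Q : Hor F G} {Q' : Hor F' G'}
    (σ : Sq f g M P) (σ' : Sq f' g' M' P') (τ : Sq g k N Q) (τ' : Sq g' k' N' Q'),
    ((σ ⊠ₛ σ') ⊙ₛ (τ ⊠ₛ τ')) ≫ᵥ x P P' Q Q' ≡ₛ x M M' N N' ≫ᵥ ((σ ⊙ₛ τ) ⊠ₛ (σ' ⊙ₛ τ'))
  x_xInv : ∀ {A B C A' B' C' : D} (M : Hor A B) (M' : Hor A' B') (N : Hor B C) (N' : Hor B' C'),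
    x M M' N N' ≫ᵥ xInv M M' N N' ≡ₛ vid ((M ⊠ M') ⊙ (N ⊠ N'))
  xInv_x : ∀ {A B C A' B' C' : D} (M : Hor A B) (M' : Hor A' B') (N : Hor B C) (N' : Hor B' C'),
    xInv M M' N N' ≫ᵥ x M M' N N' ≡ₛ vid ((M ⊙ N) ⊠ (M' ⊙ N'))
  u_natural : ∀ {A B C E : D} (f : A ⟶ C) (g : B ⟶ E),
    Usq (f ⊗ₘ g) ≫ᵥ u C E ≡ₛ u A B ≫ᵥ (Usq f ⊠ₛ Usq g)
  u_uInv : ∀ A B : D, u A B ≫ᵥ uInv A B ≡ₛ vid (U (A ⊗ B))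
  uInv_u : ∀ A B : D, uInv A B ≫ᵥ u A B ≡ₛ vid (U A ⊠ U B)
  /- the tensor product is a pseudo double functor -/
  x_assoc : ∀ {A B C E A' B' C' E' : D} (M₁ : Hor A B) (N₁ : Hor A' B') (M₂ : Hor B C)
    (N₂ : Hor B' C') (M₃ : Hor C E) (N₃ : Hor C' E'),
    (x M₁ N₁ M₂ N₂ ⊙ₛ vid (M₃ ⊠ N₃)) ≫ᵥ x (M₁ ⊙ M₂) (N₁ ⊙ N₂) M₃ N₃ ≫ᵥ (a M₁ M₂ M₃ ⊠ₛ a N₁ N₂ N₃) ≡ₛ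
      a (M₁ ⊠ N₁) (M₂ ⊠ N₂) (M₃ ⊠ N₃) ≫ᵥ (vid (M₁ ⊠ N₁) ⊙ₛ x M₂ N₂ M₃ N₃) ≫ᵥ
        x M₁ N₁ (M₂ ⊙ M₃) (N₂ ⊙ N₃)
  x_right : ∀ {A B A' B' : D} (M : Hor A B) (N : Hor A' B'),
    (vid (M ⊠ N) ⊙ₛ u B B') ≫ᵥ x M N (U B) (U B') ≫ᵥ (r M ⊠ₛ r N) ≡ₛ r (M ⊠ N)
  x_left : ∀ {A B A' B' : D} (M : Hor A B) (N : Hor A' B'),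
    (u A A' ⊙ₛ vid (M ⊠ N)) ≫ᵥ x (U A) (U A') M N ≫ᵥ (l M ⊠ₛ l N) ≡ₛ l (M ⊠ N)
  /- the associativity constraint of the tensor product is a transformation of double functors -/
  ta_hcomp : ∀ {A B C A' B' C' A'' B'' C'' : D} (M₁ : Hor A B) (N₁ : Hor A' B') (P₁ : Hor A'' B'')
    (M₂ : Hor B C) (N₂ : Hor B' C') (P₂ : Hor B'' C''),
    (ta M₁ N₁ P₁ ⊙ₛ ta M₂ N₂ P₂) ≫ᵥ x M₁ (N₁ ⊠ P₁) M₂ (N₂ ⊠ P₂) ≫ᵥ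
        (vid (M₁ ⊙ M₂) ⊠ₛ x N₁ P₁ N₂ P₂) ≡ₛ
      x (M₁ ⊠ N₁) P₁ (M₂ ⊠ N₂) P₂ ≫ᵥ (x M₁ N₁ M₂ N₂ ⊠ₛ vid (P₁ ⊙ P₂)) ≫ᵥ
        ta (M₁ ⊙ M₂) (N₁ ⊙ N₂) (P₁ ⊙ P₂)
  ta_unit : ∀ A B C : D,
    Usq (α_ A B C).hom ≫ᵥ u A (B ⊗ C) ≫ᵥ (vid (U A) ⊠ₛ u B C) ≡ₛ
      u (A ⊗ B) C ≫ᵥ (u A B ⊠ₛ vid (U C)) ≫ᵥ ta (U A) (U B) (U C)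
  /- the unit constraints of the tensor product are transformations of double functors -/
  tr_hcomp : ∀ {A B C : D} (M : Hor A B) (N : Hor B C),
    x M (U (𝟙_ D)) N (U (𝟙_ D)) ≫ᵥ (vid (M ⊙ N) ⊠ₛ l (U (𝟙_ D))) ≫ᵥ tr (M ⊙ N) ≡ₛ
      tr M ⊙ₛ tr N
  tr_unit : ∀ A : D, u A (𝟙_ D) ≫ᵥ tr (U A) ≡ₛ Usq (ρ_ A).hom
  tl_hcomp : ∀ {A B C : D} (M : Hor A B) (N : Hor B C),
    x (U (𝟙_ D)) M (U (𝟙_ D)) N ≫ᵥ (l (U (𝟙_ D)) ⊠ₛ vid (M ⊙ N)) ≫ᵥ tl (M ⊙ N) ≡ₛ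
      tl M ⊙ₛ tl N
  tl_unit : ∀ A : D, u (𝟙_ D) A ≫ᵥ tl (U A) ≡ₛ Usq (λ_ A).hom

attribute [reducible, instance] MonoidalDoubleCategory.toMonoidalData

/-! ## Lax double functors and double transformations -/

section Functors

variable {D : Type*} [Category* D] [DoubleCategory D] {E : Type*} [Category* E] [DoubleCategory E]

/-- A lax double functor. -/
structure LaxDoubleFunctor (D : Type*) [Category* D] [DoubleCategory D]
    (E : Type*) [Category* E] [DoubleCategory E] where
  /-- the functor on objects and vertical arrows -/
  F₀ : D ⥤ E
  /-- the functor on horizontal arrows and squares -/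
  hor : ∀ {A B : D}, Hor A B → Hor (F₀.obj A) (F₀.obj B)
  sq : ∀ {A B A' B' : D} {f : A ⟶ A'} {g : B ⟶ B'} {M : Hor A B} {N : Hor A' B'},
    Sq f g M N → Sq (F₀.map f) (F₀.map g) (hor M) (hor N)
  sq_vid : ∀ {A B : D} (M : Hor A B), sq (vid M) ≡ₛ vid (hor M)
  sq_vcomp : ∀ {A B A' B' A'' B'' : D} {f : A ⟶ A'} {g : B ⟶ B'} {f' : A' ⟶ A''} {g' : B' ⟶ B''}
    {M : Hor A B} {N : Hor A' B'} {P : Hor A'' B''} (σ : Sq f g M N) (τ : Sq f' g' N P),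
    sq (σ ≫ᵥ τ) ≡ₛ sq σ ≫ᵥ sq τ
  /-- the globular comparison for horizontal composition -/
  comp : ∀ {A B C : D} (M : Hor A B) (N : Hor B C),
    Sq (𝟙 (F₀.obj A)) (𝟙 (F₀.obj C)) (hor M ⊙ hor N) (hor (M ⊙ N))
  comp_natural : ∀ {A B C A' B' C' : D} {f : A ⟶ A'} {g : B ⟶ B'} {k : C ⟶ C'}
    {M : Hor A B} {N : Hor B C} {M' : Hor A' B'} {N' : Hor B' C'}
    (σ : Sq f g M M') (τ : Sq g k N N'),
    (sq σ ⊙ₛ sq τ) ≫ᵥ comp M' N' ≡ₛ comp M N ≫ᵥ sq (σ ⊙ₛ τ)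
  /-- the globular comparison for horizontal units -/
  unit : ∀ A : D, Sq (𝟙 (F₀.obj A)) (𝟙 (F₀.obj A)) (U (F₀.obj A)) (hor (U A))
  unit_natural : ∀ {A B : D} (f : A ⟶ B),
    Usq (F₀.map f) ≫ᵥ unit B ≡ₛ unit A ≫ᵥ sq (Usq f)
  assoc : ∀ {A B C G : D} (M : Hor A B) (N : Hor B C) (P : Hor C G),
    (comp M N ⊙ₛ vid (hor P)) ≫ᵥ comp (M ⊙ N) P ≫ᵥ sq (a M N P) ≡ₛ
      a (hor M) (hor N) (hor P) ≫ᵥ (vid (hor M) ⊙ₛ comp N P) ≫ᵥ comp M (N ⊙ P)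
  unit_left : ∀ {A B : D} (M : Hor A B),
    (unit A ⊙ₛ vid (hor M)) ≫ᵥ comp (U A) M ≫ᵥ sq (l M) ≡ₛ l (hor M)
  unit_right : ∀ {A B : D} (M : Hor A B),
    (vid (hor M) ⊙ₛ unit B) ≫ᵥ comp M (U B) ≫ᵥ sq (r M) ≡ₛ r (hor M)

/-- A double transformation between lax double functors. -/
structure DoubleTransformation (F G : LaxDoubleFunctor D E) where
  /-- the natural transformation on objects -/
  α₀ : F.F₀ ⟶ G.F₀
  /-- the natural transformation on horizontal arrows -/
  α₁ : ∀ {A B : D} (M : Hor A B), Sq (α₀.app A) (α₀.app B) (F.hor M) (G.hor M)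
  natural : ∀ {A B A' B' : D} {f : A ⟶ A'} {g : B ⟶ B'} {M : Hor A B} {N : Hor A' B'}
    (σ : Sq f g M N), F.sq σ ≫ᵥ α₁ N ≡ₛ α₁ M ≫ᵥ G.sq σ
  comp : ∀ {A B C : D} (M : Hor A B) (N : Hor B C),
    F.comp M N ≫ᵥ α₁ (M ⊙ N) ≡ₛ (α₁ M ⊙ₛ α₁ N) ≫ᵥ G.comp M N
  unit : ∀ A : D, F.unit A ≫ᵥ α₁ (U A) ≡ₛ Usq (α₀.app A) ≫ᵥ G.unit A

end Functors

/-! ## Vertical 2-cells -/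

section VerticalCells

variable {D : Type*} [Category* D] [DoubleCategory D]

/-- A vertical 2-cell `f ⟹ g` between parallel vertical arrows. (For profunctors these are the
natural transformations `f ⟶ g`.) -/
abbrev VCell {A B : D} (f g : A ⟶ B) := Sq f g (U A) (U B)

/-- Replace the sides of a square by equal ones. -/
def castSq {A B A' B' : D} {f f' : A ⟶ A'} {g g' : B ⟶ B'} {M : Hor A B} {N : Hor A' B'}
    (hf : f = f') (hg : g = g') (σ : Sq f g M N) : Sq f' g' M N :=
  hf ▸ hg ▸ σ

/-- Composition of vertical 2-cells `f ⟹ g = g' ⟹ k`. -/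
def vtrans {A B : D} {f g g' k : A ⟶ B} (e : g = g') (θ : VCell f g) (θ' : VCell g' k) :
    VCell f k :=
  castSq (by simp) (by simp) (lInv (U A) ≫ᵥ (θ ⊙ₛ castSq e.symm rfl θ') ≫ᵥ l (U B))

/-- Invertible vertical 2-cells. -/
structure VIso {A B : D} (f g : A ⟶ B) where
  hom : VCell f g
  inv : VCell g f
  hom_inv : vtrans rfl hom inv = Usq f
  inv_hom : vtrans rfl inv hom = Usq g

/-- The vertical 2-cells `θ : f ⟹ g` and `θ' : f' ⟹ g'` carry the square `σ` with sides `f, f'`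
to the square `τ` with sides `g, g'`: the horizontal composites `θ ⊙ τ` and `σ ⊙ θ'` agree. -/
def Intertwines {A B A' B' : D} {f g : A ⟶ A'} {f' g' : B ⟶ B'} {M : Hor A B} {N : Hor A' B'}
    (θ : VCell f g) (θ' : VCell f' g') (σ : Sq f f' M N) (τ : Sq g g' M N) : Prop :=
  lInv M ≫ᵥ (θ ⊙ₛ τ) ≫ᵥ l N ≡ₛ rInv M ≫ᵥ (σ ⊙ₛ θ') ≫ᵥ r N

/-- Tensor product of vertical 2-cells. -/
def vtensor [MonoidalCategory D] [MonoidalDoubleCategory D] {A B A' B' : D} {f g : A ⟶ B}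
    {f' g' : A' ⟶ B'} (θ : VCell f g) (θ' : VCell f' g') : VCell (f ⊗ₘ f') (g ⊗ₘ g') :=
  castSq (by simp) (by simp) (u A A' ≫ᵥ (θ ⊠ₛ θ') ≫ᵥ uInv B B')

end VerticalCells

/-! ## Lax monoidal double functors and monoidal double transformations -/

section Monoidal

variable {D : Type*} [Category* D] [MonoidalCategory D] [DoubleCategory D]
  [MonoidalDoubleCategory D] {E : Type*} [Category* E] [MonoidalCategory E] [DoubleCategory E]
  [MonoidalDoubleCategory E]

/-- A lax monoidal double functor. The associativity and unit conditions on the lax monoidal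
structure hold up to the specified invertible vertical 2-cells `assocCell`, `leftCell`,
`rightCell`, which are natural with respect to vertical and horizontal arrows and coherent; all
other conditions hold strictly. -/
structure LaxMonoidalDoubleFunctor (D : Type*) [Category* D] [MonoidalCategory D]
    [DoubleCategory D] [MonoidalDoubleCategory D] (E : Type*) [Category* E] [MonoidalCategory E]
    [DoubleCategory E] [MonoidalDoubleCategory E] extends LaxDoubleFunctor D E where
  /-- the laxity of the functor on objects -/
  μ : ∀ A B : D, F₀.obj A ⊗ F₀.obj B ⟶ F₀.obj (A ⊗ B)
  μ_natural : ∀ {A B A' B' : D} (f : A ⟶ A') (g : B ⟶ B'),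
    (F₀.map f ⊗ₘ F₀.map g) ≫ μ A' B' = μ A B ≫ F₀.map (f ⊗ₘ g)
  ε : 𝟙_ E ⟶ F₀.obj (𝟙_ D)
  /-- the laxity of the functor on horizontal arrows, which lies over that on objects -/
  ν : ∀ {A B A' B' : D} (M : Hor A B) (M' : Hor A' B'),
    Sq (μ A A') (μ B B') (hor M ⊠ hor M') (hor (M ⊠ M'))
  ν_natural : ∀ {A B A' B' C G C' G' : D} {f : A ⟶ C} {g : B ⟶ G} {f' : A' ⟶ C'} {g' : B' ⟶ G'}
    {M : Hor A B} {N : Hor C G} {M' : Hor A' B'} {N' : Hor C' G'} (σ : Sq f g M N)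
    (σ' : Sq f' g' M' N'), (sq σ ⊠ₛ sq σ') ≫ᵥ ν N N' ≡ₛ ν M M' ≫ᵥ sq (σ ⊠ₛ σ')
  δ : Sq ε ε (U (𝟙_ E)) (hor (U (𝟙_ D)))
  /-- associativity of the laxity, on objects -/
  assocCell : ∀ A B C : D,
    VIso ((μ A B ⊗ₘ 𝟙 (F₀.obj C)) ≫ μ (A ⊗ B) C ≫ F₀.map (α_ A B C).hom)
      ((α_ (F₀.obj A) (F₀.obj B) (F₀.obj C)).hom ≫ (𝟙 (F₀.obj A) ⊗ₘ μ B C) ≫ μ A (B ⊗ C))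
  assocCell_natural : ∀ {A B C A' B' C' : D} (f : A ⟶ A') (g : B ⟶ B') (k : C ⟶ C'),
    Usq ((F₀.map f ⊗ₘ F₀.map g) ⊗ₘ F₀.map k) ≫ᵥ (assocCell A' B' C').hom ≡ₛ
      (assocCell A B C).hom ≫ᵥ Usq (F₀.map (f ⊗ₘ (g ⊗ₘ k)))
  /-- associativity of the laxity, on horizontal arrows -/
  assocCell_ν : ∀ {A B C A' B' C' : D} (M : Hor A A') (N : Hor B B') (P : Hor C C'),
    Intertwines (assocCell A B C).hom (assocCell A' B' C').hom
      ((ν M N ⊠ₛ vid (hor P)) ≫ᵥ ν (M ⊠ N) P ≫ᵥ sq (ta M N P))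
      (ta (hor M) (hor N) (hor P) ≫ᵥ (vid (hor M) ⊠ₛ ν N P) ≫ᵥ ν M (N ⊠ P))
  /-- left unitality of the laxity, on objects -/
  leftCell : ∀ A : D,
    VIso ((ε ⊗ₘ 𝟙 (F₀.obj A)) ≫ μ (𝟙_ D) A ≫ F₀.map (λ_ A).hom) (λ_ (F₀.obj A)).hom
  leftCell_natural : ∀ {A A' : D} (f : A ⟶ A'),
    Usq (𝟙 (𝟙_ E) ⊗ₘ F₀.map f) ≫ᵥ (leftCell A').hom ≡ₛ (leftCell A).hom ≫ᵥ Usq (F₀.map f)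
  /-- left unitality of the laxity, on horizontal arrows -/
  leftCell_ν : ∀ {A A' : D} (M : Hor A A'),
    Intertwines (leftCell A).hom (leftCell A').hom
      ((δ ⊠ₛ vid (hor M)) ≫ᵥ ν (U (𝟙_ D)) M ≫ᵥ sq (tl M)) (tl (hor M))
  /-- right unitality of the laxity, on objects -/
  rightCell : ∀ A : D,
    VIso ((𝟙 (F₀.obj A) ⊗ₘ ε) ≫ μ A (𝟙_ D) ≫ F₀.map (ρ_ A).hom) (ρ_ (F₀.obj A)).hom
  rightCell_natural : ∀ {A A' : D} (f : A ⟶ A'),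
    Usq (F₀.map f ⊗ₘ 𝟙 (𝟙_ E)) ≫ᵥ (rightCell A').hom ≡ₛ (rightCell A).hom ≫ᵥ Usq (F₀.map f)
  /-- right unitality of the laxity, on horizontal arrows -/
  rightCell_ν : ∀ {A A' : D} (M : Hor A A'),
    Intertwines (rightCell A).hom (rightCell A').hom
      ((vid (hor M) ⊠ₛ δ) ≫ᵥ ν M (U (𝟙_ D)) ≫ᵥ sq (tr M)) (tr (hor M))
  /-- coherence of the vertical 2-cells: the pentagon -/
  cell_pentagon : ∀ A B C G : D,
    vtrans (by
        simp only [Category.assoc, associator_naturality_assoc, tensorHom_comp_tensorHom_assoc,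
        id_tensorHom_id, Category.id_comp, Category.comp_id])
      (Usq ((μ A B ⊗ₘ 𝟙 (F₀.obj C)) ⊗ₘ 𝟙 (F₀.obj G)) ≫ᵥ (assocCell (A ⊗ B) C G).hom ≫ᵥ
        Usq (F₀.map (α_ A B (C ⊗ G)).hom))
      (Usq ((α_ (F₀.obj A ⊗ F₀.obj B) (F₀.obj C) (F₀.obj G)).hom ≫
        (𝟙 (F₀.obj A ⊗ F₀.obj B) ⊗ₘ μ C G)) ≫ᵥ (assocCell A B (C ⊗ G)).hom) ≡ₛ
    vtrans (by
        have h := μ_natural (𝟙 A) (α_ B C G).hom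
        simp only [F₀.map_id] at h
        simp only [Category.assoc, ← h]
        simp)
      (vtrans (by simp)
        (vtensor (assocCell A B C).hom (Usq (𝟙 (F₀.obj G))) ≫ᵥ
          Usq (μ (A ⊗ (B ⊗ C)) G ≫ F₀.map (α_ A (B ⊗ C) G).hom ≫
            F₀.map (𝟙 A ⊗ₘ (α_ B C G).hom)))
        (Usq (((α_ (F₀.obj A) (F₀.obj B) (F₀.obj C)).hom ≫ (𝟙 (F₀.obj A) ⊗ₘ μ B C)) ⊗ₘ
          𝟙 (F₀.obj G)) ≫ᵥ (assocCell A (B ⊗ C) G).hom ≫ᵥ Usq (F₀.map (𝟙 A ⊗ₘ (α_ B C G).hom))))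
      (Usq (((α_ (F₀.obj A) (F₀.obj B) (F₀.obj C)).hom ⊗ₘ 𝟙 (F₀.obj G)) ≫
          (α_ (F₀.obj A) (F₀.obj B ⊗ F₀.obj C) (F₀.obj G)).hom) ≫ᵥ
        vtensor (Usq (𝟙 (F₀.obj A))) (assocCell B C G).hom ≫ᵥ Usq (μ A (B ⊗ (C ⊗ G))))
  /-- coherence of the vertical 2-cells: the triangle -/
  cell_triangle : ∀ A B : D,
    vtrans (by
        have h := μ_natural (𝟙 A) (λ_ B).hom
        simp only [F₀.map_id] at h
        simp only [Category.assoc, ← h]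
        simp)
      (Usq ((𝟙 (F₀.obj A) ⊗ₘ ε) ⊗ₘ 𝟙 (F₀.obj B)) ≫ᵥ (assocCell A (𝟙_ D) B).hom ≫ᵥ
        Usq (F₀.map (𝟙 A ⊗ₘ (λ_ B).hom)))
      (Usq (α_ (F₀.obj A) (𝟙_ E) (F₀.obj B)).hom ≫ᵥ
        vtensor (Usq (𝟙 (F₀.obj A))) (leftCell B).hom ≫ᵥ Usq (μ A B)) ≡ₛ
    vtensor (rightCell A).hom (Usq (𝟙 (F₀.obj B))) ≫ᵥ Usq (μ A B)
  /- the comparisons for horizontal composition and units are monoidal transformations -/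
  comp_tensor : ∀ {A B C A' B' C' : D} (M : Hor A B) (M' : Hor A' B') (N : Hor B C)
    (N' : Hor B' C'),
    x (hor M) (hor M') (hor N) (hor N') ≫ᵥ (comp M N ⊠ₛ comp M' N') ≫ᵥ ν (M ⊙ N) (M' ⊙ N') ≡ₛ
      (ν M M' ⊙ₛ ν N N') ≫ᵥ comp (M ⊠ M') (N ⊠ N') ≫ᵥ sq (x M M' N N')
  comp_tensorUnit :
    (δ ⊙ₛ δ) ≫ᵥ comp (U (𝟙_ D)) (U (𝟙_ D)) ≫ᵥ sq (l (U (𝟙_ D))) ≡ₛ l (U (𝟙_ E)) ≫ᵥ δ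
  unit_tensor : ∀ A B : D,
    u (F₀.obj A) (F₀.obj B) ≫ᵥ (unit A ⊠ₛ unit B) ≫ᵥ ν (U A) (U B) ≡ₛ
      Usq (μ A B) ≫ᵥ unit (A ⊗ B) ≫ᵥ sq (u A B)
  unit_tensorUnit : δ ≡ₛ Usq ε ≫ᵥ unit (𝟙_ D)

/-- A monoidal double transformation. The compatibility with the laxities holds up to the
specified invertible vertical 2-cells `tensorCell` and `unitCell`, which are natural with respect
to vertical and horizontal arrows and coherent. -/
structure MonoidalDoubleTransformation (F G : LaxMonoidalDoubleFunctor D E) extends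
    DoubleTransformation F.toLaxDoubleFunctor G.toLaxDoubleFunctor where
  /-- compatibility with tensor products, on objects -/
  tensorCell : ∀ A B : D,
    VIso (F.μ A B ≫ α₀.app (A ⊗ B)) ((α₀.app A ⊗ₘ α₀.app B) ≫ G.μ A B)
  tensorCell_natural : ∀ {A B A' B' : D} (f : A ⟶ A') (g : B ⟶ B'),
    Usq (F.F₀.map f ⊗ₘ F.F₀.map g) ≫ᵥ (tensorCell A' B').hom ≡ₛ
      (tensorCell A B).hom ≫ᵥ Usq (G.F₀.map (f ⊗ₘ g))
  /-- compatibility with tensor products, on horizontal arrows -/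
  tensorCell_ν : ∀ {A B A' B' : D} (M : Hor A A') (N : Hor B B'),
    Intertwines (tensorCell A B).hom (tensorCell A' B').hom
      (F.ν M N ≫ᵥ α₁ (M ⊠ N)) ((α₁ M ⊠ₛ α₁ N) ≫ᵥ G.ν M N)
  /-- compatibility with units, on objects -/
  unitCell : VIso (F.ε ≫ α₀.app (𝟙_ D)) G.ε
  /-- compatibility with units, on horizontal arrows -/
  unitCell_δ : Intertwines unitCell.hom unitCell.hom (F.δ ≫ᵥ α₁ (U (𝟙_ D))) G.δ
  /-- coherence with the associativity cells -/
  cell_assoc : ∀ A B C : D,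
    vtrans (by
        simp only [Category.assoc, associator_naturality_assoc, tensorHom_comp_tensorHom_assoc,
          id_tensorHom_id, Category.id_comp, Category.comp_id])
      (vtrans (by simp)
        ((F.assocCell A B C).hom ≫ᵥ Usq (α₀.app (A ⊗ (B ⊗ C))))
        (Usq ((α_ (F.F₀.obj A) (F.F₀.obj B) (F.F₀.obj C)).hom ≫ (𝟙 (F.F₀.obj A) ⊗ₘ F.μ B C)) ≫ᵥ
          (tensorCell A (B ⊗ C)).hom))
      (Usq (α_ (F.F₀.obj A) (F.F₀.obj B) (F.F₀.obj C)).hom ≫ᵥ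
        vtensor (Usq (α₀.app A)) (tensorCell B C).hom ≫ᵥ Usq (G.μ A (B ⊗ C))) ≡ₛ
    vtrans (by
        simp only [Category.assoc, associator_naturality_assoc, tensorHom_comp_tensorHom_assoc,
          id_tensorHom_id, Category.id_comp, Category.comp_id])
      (vtrans (by
        simp only [Category.assoc, associator_naturality_assoc, tensorHom_comp_tensorHom_assoc,
          id_tensorHom_id, Category.id_comp, Category.comp_id])
        (Usq (F.μ A B ⊗ₘ 𝟙 (F.F₀.obj C)) ≫ᵥ (tensorCell (A ⊗ B) C).hom ≫ᵥ
          Usq (G.F₀.map (α_ A B C).hom))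
        (vtensor (tensorCell A B).hom (Usq (α₀.app C)) ≫ᵥ
          Usq (G.μ (A ⊗ B) C ≫ G.F₀.map (α_ A B C).hom)))
      (Usq ((α₀.app A ⊗ₘ α₀.app B) ⊗ₘ α₀.app C) ≫ᵥ (G.assocCell A B C).hom)
  /-- coherence with the left unit cells -/
  cell_left : ∀ A : D,
    vtrans (by
        simp only [Category.assoc, associator_naturality_assoc, tensorHom_comp_tensorHom_assoc,
          id_tensorHom_id, Category.id_comp, Category.comp_id])
      (vtrans (by
        simp only [Category.assoc, associator_naturality_assoc, tensorHom_comp_tensorHom_assoc,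
          id_tensorHom_id, Category.id_comp, Category.comp_id])
        (Usq (F.ε ⊗ₘ 𝟙 (F.F₀.obj A)) ≫ᵥ (tensorCell (𝟙_ D) A).hom ≫ᵥ
          Usq (G.F₀.map (λ_ A).hom))
        (vtensor unitCell.hom (Usq (α₀.app A)) ≫ᵥ
          Usq (G.μ (𝟙_ D) A ≫ G.F₀.map (λ_ A).hom)))
      (Usq (𝟙 (𝟙_ E) ⊗ₘ α₀.app A) ≫ᵥ (G.leftCell A).hom) ≡ₛ
    (F.leftCell A).hom ≫ᵥ Usq (α₀.app A)
  /-- coherence with the right unit cells -/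
  cell_right : ∀ A : D,
    vtrans (by
        simp only [Category.assoc, associator_naturality_assoc, tensorHom_comp_tensorHom_assoc,
          id_tensorHom_id, Category.id_comp, Category.comp_id])
      (vtrans (by
        simp only [Category.assoc, associator_naturality_assoc, tensorHom_comp_tensorHom_assoc,
          id_tensorHom_id, Category.id_comp, Category.comp_id])
        (Usq (𝟙 (F.F₀.obj A) ⊗ₘ F.ε) ≫ᵥ (tensorCell A (𝟙_ D)).hom ≫ᵥ
          Usq (G.F₀.map (ρ_ A).hom))
        (vtensor (Usq (α₀.app A)) unitCell.hom ≫ᵥ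
          Usq (G.μ A (𝟙_ D) ≫ G.F₀.map (ρ_ A).hom)))
      (Usq (α₀.app A ⊗ₘ 𝟙 (𝟙_ E)) ≫ᵥ (G.rightCell A).hom) ≡ₛ
    (F.rightCell A).hom ≫ᵥ Usq (α₀.app A)

end Monoidal

end DoubleCat

/-! ## The double category of categories and profunctors -/

namespace Prof

open DoubleCat DoubleData MonoidalDoubleData

section Profunctors

variable {C : Type w} [SmallCategory C] {D : Type w} [SmallCategory D]
  {E : Type w} [SmallCategory E]

/-- The set `M(c, d)` of elements of a profunctor `M : Cᵒᵖ × D ⥤ Type w` from `C` to `D`. -/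
abbrev El (M : Profunctor.{w} D C) (c : C) (d : D) : Type w := (M.obj d).obj (op c)

/-- The left (contravariant) action of arrows on elements. -/
def lact (M : Profunctor.{w} D C) {c c' : C} {d : D} (f : c' ⟶ c) (m : El M c d) : El M c' d :=
  (M.obj d).map f.op m

/-- The right (covariant) action of arrows on elements. -/
def ract (M : Profunctor.{w} D C) {c : C} {d d' : D} (g : d ⟶ d') (m : El M c d) : El M c d' :=
  (M.map g).app (op c) m

theorem lact_id (M : Profunctor.{w} D C) {c : C} {d : D} (m : El M c d) :
    lact M (𝟙 c) m = m := by
  simp [lact]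

theorem ract_id (M : Profunctor.{w} D C) {c : C} {d : D} (m : El M c d) :
    ract M (𝟙 d) m = m := by
  simp [ract]

theorem lact_comp (M : Profunctor.{w} D C) {c c' c'' : C} {d : D} (f : c' ⟶ c) (f' : c'' ⟶ c')
    (m : El M c d) : lact M (f' ≫ f) m = lact M f' (lact M f m) := by
  simp [lact]

theorem ract_comp (M : Profunctor.{w} D C) {c : C} {d d' d'' : D} (g : d ⟶ d') (g' : d' ⟶ d'')
    (m : El M c d) : ract M (g ≫ g') m = ract M g' (ract M g m) := by
  simp [ract]

theorem lact_ract (M : Profunctor.{w} D C) {c c' : C} {d d' : D} (f : c' ⟶ c) (g : d ⟶ d')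
    (m : El M c d) : lact M f (ract M g m) = ract M g (lact M f m) := by
  have := (M.map g).naturality f.op
  exact (congrArg (fun k => k m) this).symm

/-- A profunctor from its sets of elements and the two commuting actions. -/
def ofActions (el : C → D → Type w)
    (l : ∀ {c c' : C} {d : D}, (c' ⟶ c) → el c d → el c' d)
    (r : ∀ {c : C} {d d' : D}, (d ⟶ d') → el c d → el c d')
    (l_id : ∀ {c : C} {d : D} (m : el c d), l (𝟙 c) m = m)
    (r_id : ∀ {c : C} {d : D} (m : el c d), r (𝟙 d) m = m)
    (l_comp : ∀ {c c' c'' : C} {d : D} (f : c' ⟶ c) (f' : c'' ⟶ c') (m : el c d),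
      l (f' ≫ f) m = l f' (l f m))
    (r_comp : ∀ {c : C} {d d' d'' : D} (g : d ⟶ d') (g' : d' ⟶ d'') (m : el c d),
      r (g ≫ g') m = r g' (r g m))
    (l_r : ∀ {c c' : C} {d d' : D} (f : c' ⟶ c) (g : d ⟶ d') (m : el c d),
      l f (r g m) = r g (l f m)) : Profunctor.{w} D C where
  obj d :=
    { obj c := el c.unop d
      map f := TypeCat.ofHom (l f.unop)
      map_id c := by ext m; exact l_id m
      map_comp f g := by ext m; exact l_comp f.unop g.unop m }
  map g :=
    { app c := TypeCat.ofHom (r g)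
      naturality c c' f := by ext m; exact (l_r f.unop g m).symm }
  map_id d := by ext c m; exact r_id m
  map_comp g g' := by ext c m; exact r_comp g g' m

/-- The relation generating the coend `∫ d, M(c, d) × N(d, e)`. -/
inductive CoendRel (M : Profunctor.{w} D C) (N : Profunctor.{w} E D) (c : C) (e : E) :
    (Σ d : D, El M c d × El N d e) → (Σ d : D, El M c d × El N d e) → Prop
  | mk {d d' : D} (g : d ⟶ d') (m : El M c d) (n : El N d' e) :
    CoendRel M N c e ⟨d', ract M g m, n⟩ ⟨d, m, lact N g n⟩

/-- The coend `∫ d, M(c, d) × N(d, e)`. -/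
def CompEl (M : Profunctor.{w} D C) (N : Profunctor.{w} E D) (c : C) (e : E) : Type w :=
  Quot (CoendRel M N c e)

/-- The class of a pair of elements in the coend. -/
def CompEl.mk {M : Profunctor.{w} D C} {N : Profunctor.{w} E D} {c : C} {e : E} {d : D}
    (m : El M c d) (n : El N d e) : CompEl M N c e :=
  Quot.mk _ ⟨d, m, n⟩

theorem CompEl.sound {M : Profunctor.{w} D C} {N : Profunctor.{w} E D} {c : C} {e : E} {d d' : D}
    (g : d ⟶ d') (m : El M c d) (n : El N d' e) :
    CompEl.mk (ract M g m) n = CompEl.mk m (lact N g n) :=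
  Quot.sound (CoendRel.mk g m n)

theorem CompEl.ind {M : Profunctor.{w} D C} {N : Profunctor.{w} E D} {c : C} {e : E}
    {p : CompEl M N c e → Prop} (h : ∀ (d : D) (m : El M c d) (n : El N d e), p (CompEl.mk m n))
    (k : CompEl M N c e) : p k :=
  Quot.ind (fun ⟨d, m, n⟩ => h d m n) k

/-- Functions out of the coend. -/
def CompEl.lift {M : Profunctor.{w} D C} {N : Profunctor.{w} E D} {c : C} {e : E} {X : Type*}
    (φ : ∀ d : D, El M c d → El N d e → X)
    (h : ∀ (d d' : D) (g : d ⟶ d') (m : El M c d) (n : El N d' e),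
      φ d' (ract M g m) n = φ d m (lact N g n)) : CompEl M N c e → X :=
  Quot.lift (fun k => φ k.1 k.2.1 k.2.2) (by rintro _ _ ⟨g, m, n⟩; exact h _ _ g m n)

/-- Composition of profunctors. -/
def comp (M : Profunctor.{w} D C) (N : Profunctor.{w} E D) : Profunctor.{w} E C :=
  ofActions (CompEl M N)
    (fun f => CompEl.lift (fun _ m n => CompEl.mk (lact M f m) n)
      (fun _ _ g m n => by rw [lact_ract]; exact CompEl.sound _ _ _))
    (fun f => CompEl.lift (fun _ m n => CompEl.mk m (ract N f n))
      (fun _ _ g m n => by rw [← lact_ract]; exact CompEl.sound _ _ _))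
    (CompEl.ind fun d m n => congrArg (CompEl.mk · n) (lact_id M m))
    (CompEl.ind fun d m n => congrArg (CompEl.mk m ·) (ract_id N n))
    (fun f f' => CompEl.ind fun d m n => congrArg (CompEl.mk · n) (lact_comp M f f' m))
    (fun g g' => CompEl.ind fun d m n => congrArg (CompEl.mk m ·) (ract_comp N g g' n))
    (fun f g => CompEl.ind fun d m n => rfl)

/-- Cartesian product of profunctors. -/
def prod {C' : Type w} [SmallCategory C'] {D' : Type w} [SmallCategory D']
    (M : Profunctor.{w} D C) (N : Profunctor.{w} D' C') : Profunctor.{w} (D × D') (C × C') :=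
  ofActions (fun c d => El M c.1 d.1 × El N c.2 d.2)
    (fun f m => (lact M f.1 m.1, lact N f.2 m.2))
    (fun g m => (ract M g.1 m.1, ract N g.2 m.2))
    (fun m => Prod.ext (lact_id M m.1) (lact_id N m.2))
    (fun m => Prod.ext (ract_id M m.1) (ract_id N m.2))
    (fun f f' m => Prod.ext (lact_comp M f.1 f'.1 m.1) (lact_comp N f.2 f'.2 m.2))
    (fun g g' m => Prod.ext (ract_comp M g.1 g'.1 m.1) (ract_comp N g.2 g'.2 m.2))
    (fun f g m => Prod.ext (lact_ract M f.1 g.1 m.1) (lact_ract N f.2 g.2 m.2))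

end Profunctors

/-- A square of profunctors: a natural family of maps `M(c, d) → N(F c, G d)`. -/
@[ext]
structure Square {A B A' B' : Cat.{w, w}} (F : A ⟶ A') (G : B ⟶ B')
    (M : Profunctor.{w} B A) (N : Profunctor.{w} B' A') : Type w where
  app : ∀ {c : A} {d : B}, El M c d → El N (F.toFunctor.obj c) (G.toFunctor.obj d)
  app_lact : ∀ {c c' : A} {d : B} (f : c' ⟶ c) (m : El M c d),
    app (lact M f m) = lact N (F.toFunctor.map f) (app m)
  app_ract : ∀ {c : A} {d d' : B} (g : d ⟶ d') (m : El M c d),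
    app (ract M g m) = ract N (G.toFunctor.map g) (app m)

instance : DoubleData.{w, w + 1} Cat.{w, w} where
  Hor A B := Profunctor.{w} B A
  Sq := Square
  vid M := ⟨fun m => m, fun _ _ => rfl, fun _ _ => rfl⟩
  vcomp σ τ := ⟨fun m => τ.app (σ.app m),
    fun f m => by rw [σ.app_lact, τ.app_lact]; rfl,
    fun g m => by rw [σ.app_ract, τ.app_ract]; rfl⟩
  U A := Profunctor.id
  Usq F := ⟨fun m => F.toFunctor.map m, fun f m => F.toFunctor.map_comp f m,
    fun g m => F.toFunctor.map_comp m g⟩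
  hcomp M N := comp M N
  hsq σ τ := ⟨CompEl.lift (fun _ m n => CompEl.mk (σ.app m) (τ.app n))
      (fun _ _ g m n => by rw [σ.app_ract, τ.app_lact]; exact CompEl.sound _ _ _),
    fun f => CompEl.ind fun d m n => congrArg (CompEl.mk · (τ.app n)) (σ.app_lact f m),
    fun g => CompEl.ind fun d m n => congrArg (CompEl.mk (σ.app m) ·) (τ.app_ract g n)⟩
  a M N P := ⟨CompEl.lift (fun _ k p => CompEl.lift
        (fun _ m n => CompEl.mk (M := M) (N := comp N P) m (CompEl.mk n p))
        (fun _ _ g m n => CompEl.sound (M := M) (N := comp N P) g m (CompEl.mk n p)) k)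
      (fun _ _ g k p => by
        revert k
        exact CompEl.ind fun d m n =>
          congrArg (CompEl.mk (M := M) (N := comp N P) m ·) (CompEl.sound g n p)),
    fun f => CompEl.ind fun _ k p => by
      revert k; exact CompEl.ind fun _ m n => rfl,
    fun g => CompEl.ind fun _ k p => by
      revert k; exact CompEl.ind fun _ m n => rfl⟩
  aInv M N P := ⟨CompEl.lift (fun _ m k => CompEl.lift
        (fun _ n p => CompEl.mk (M := comp M N) (N := P) (CompEl.mk m n) p)
        (fun _ _ g n p => CompEl.sound (M := comp M N) (N := P) g (CompEl.mk m n) p) k)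
      (fun _ _ g m k => by
        revert k
        exact CompEl.ind fun d n p =>
          congrArg (CompEl.mk (M := comp M N) (N := P) · p) (CompEl.sound g m n)),
    fun f => CompEl.ind fun _ m k => by
      revert k; exact CompEl.ind fun _ n p => rfl,
    fun g => CompEl.ind fun _ m k => by
      revert k; exact CompEl.ind fun _ n p => rfl⟩
  l M := ⟨CompEl.lift (fun _ f m => lact M f m) (fun _ _ g f m => lact_comp M g f m),
    fun f => CompEl.ind fun _ f' m => lact_comp M f' f m,
    fun g => CompEl.ind fun _ f' m => lact_ract M f' g m⟩
  lInv {A B} M := ⟨fun {c d} m => CompEl.mk (M := Profunctor.id) (N := M) (𝟙 c) m,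
    fun f m => by
      refine (CompEl.sound (M := Profunctor.id) (N := M) f (𝟙 _) m).symm.trans ?_
      refine congrArg (CompEl.mk (M := Profunctor.id) (N := M) · m) ?_
      exact (Category.id_comp f).trans (Category.comp_id f).symm,
    fun g m => rfl⟩
  r M := ⟨CompEl.lift (fun _ m f => ract M f m) (fun _ _ g m f => (ract_comp M g f m).symm),
    fun f => CompEl.ind fun _ m f' => (lact_ract M f f' m).symm,
    fun g => CompEl.ind fun _ m f' => ract_comp M f' g m⟩
  rInv {A B} M := ⟨fun {c d} m => CompEl.mk (M := M) (N := Profunctor.id) m (𝟙 d),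
    fun f m => rfl,
    fun g m => by
      refine (CompEl.sound (M := M) (N := Profunctor.id) g m (𝟙 _)).trans ?_
      refine congrArg (CompEl.mk (M := M) (N := Profunctor.id) m ·) ?_
      exact (Category.comp_id g).trans (Category.id_comp g).symm⟩


theorem Square.eq {A B A' B' : Cat.{w, w}} {F : A ⟶ A'} {G : B ⟶ B'}
    {M : Hor A B} {N : Hor A' B'} {σ τ : Sq F G M N}
    (h : ∀ (c : A) (d : B) (m : El M c d), Square.app σ m = Square.app τ m) : σ = τ :=
  Square.ext (funext fun c => funext fun d => funext fun m => h c d m)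

theorem Square.sqEq {A B A' B' : Cat.{w, w}} {F F' : A ⟶ A'} {G G' : B ⟶ B'}
    {M : Hor A B} {N : Hor A' B'} {σ : Sq F G M N} {τ : Sq F' G' M N} (hF : F = F') (hG : G = G')
    (h : ∀ (c : A) (d : B) (m : El M c d), HEq (Square.app σ m) (Square.app τ m)) : σ ≡ₛ τ := by
  subst hF hG
  exact ⟨rfl, rfl, heq_of_eq (Square.eq fun c d m => eq_of_heq (h c d m))⟩

theorem ind {A B C : Cat.{w, w}} {M : Hor A B} {N : Hor B C} {c : A} {e : C}
    {p : El (M ⊙ N) c e → Prop}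
    (h : ∀ (d : B) (m : El M c d) (n : El N d e), p (CompEl.mk (M := M) (N := N) m n))
    (k : El (M ⊙ N) c e) : p k :=
  CompEl.ind (p := p) h k

instance : DoubleCategory.{w, w + 1} Cat.{w, w} where
  vid_vcomp σ := ⟨rfl, rfl, HEq.rfl⟩
  vcomp_vid σ := ⟨rfl, rfl, HEq.rfl⟩
  vcomp_assoc σ τ ρ := ⟨rfl, rfl, HEq.rfl⟩
  Usq_id A := rfl
  Usq_comp F G := rfl
  hsq_vid M N := by
    refine Square.eq fun c d k => ?_
    induction k using ind with | h _ m n => rfl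
  hsq_vcomp σ τ σ' τ' := by
    refine Square.eq fun c d k => ?_
    induction k using ind with | h _ m n => rfl
  a_natural σ τ ρ := by
    refine Square.sqEq rfl rfl fun c d k => heq_of_eq ?_
    induction k using ind with | h _ k p => induction k using ind with | h _ m n => rfl
  a_aInv M N P := by
    refine Square.sqEq rfl rfl fun c d k => heq_of_eq ?_
    induction k using ind with | h _ k p => induction k using ind with | h _ m n => rfl
  aInv_a M N P := by
    refine Square.sqEq rfl rfl fun c d k => heq_of_eq ?_
    induction k using ind with | h _ m k => induction k using ind with | h _ n p => rfl
  l_natural σ := by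
    refine Square.sqEq rfl rfl fun c d k => heq_of_eq ?_
    induction k using ind with | h _ f m => exact (Square.app_lact σ f m).symm
  l_lInv M := by
    refine Square.sqEq rfl rfl fun c d k => heq_of_eq ?_
    induction k using ind with
    | h _ f m =>
      refine (CompEl.sound (M := Profunctor.id) (N := M) f (𝟙 _) m).symm.trans ?_
      exact congrArg (CompEl.mk (M := Profunctor.id) (N := M) · m) (Category.id_comp f)
  lInv_l M := Square.sqEq rfl rfl fun c d m => heq_of_eq (lact_id M m)
  r_natural σ := by
    refine Square.sqEq rfl rfl fun c d k => heq_of_eq ?_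
    induction k using ind with | h _ m f => exact (Square.app_ract σ f m).symm
  r_rInv M := by
    refine Square.sqEq rfl rfl fun c d k => heq_of_eq ?_
    induction k using ind with
    | h _ m f =>
      refine (CompEl.sound (M := M) (N := Profunctor.id) f m (𝟙 _)).trans ?_
      exact congrArg (CompEl.mk (M := M) (N := Profunctor.id) m ·) (Category.comp_id f)
  rInv_r M := Square.sqEq rfl rfl fun c d m => heq_of_eq (ract_id M m)
  triangle M N := by
    refine Square.sqEq rfl rfl fun c d k => heq_of_eq ?_
    induction k using ind with
    | h _ k n => induction k using ind with
      | h _ m f => exact (CompEl.sound (M := M) (N := N) f m n).symm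
  pentagon M N P Q := by
    refine Square.sqEq rfl rfl fun c d k => heq_of_eq ?_
    induction k using ind with
    | h _ k q => induction k using ind with
      | h _ k p => induction k using ind with
        | h _ m n => rfl

instance : MonoidalDoubleData.{w, w + 1} Cat.{w, w} where
  tHor {A B A' B'} M N :=
    (prod (C := A) (D := B) (C' := A') (D' := B') M N : Profunctor.{w} (B × B') (A × A'))
  tSq σ τ := ⟨fun m => (σ.app m.1, τ.app m.2),
    fun f m => Prod.ext (σ.app_lact f.1 m.1) (τ.app_lact f.2 m.2),
    fun g m => Prod.ext (σ.app_ract g.1 m.1) (τ.app_ract g.2 m.2)⟩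
  ta M N P := ⟨fun m => (m.1.1, (m.1.2, m.2)), fun f m => rfl, fun g m => rfl⟩
  taInv M N P := ⟨fun m => ((m.1, m.2.1), m.2.2), fun f m => rfl, fun g m => rfl⟩
  tl M := ⟨fun m => m.2, fun f m => rfl, fun g m => rfl⟩
  tlInv M := ⟨fun m => (𝟙 _, m), fun f m => rfl, fun g m => rfl⟩
  tr M := ⟨fun m => m.1, fun f m => rfl, fun g m => rfl⟩
  trInv M := ⟨fun m => (m, 𝟙 _), fun f m => rfl, fun g m => rfl⟩
  x M M' N N' := ⟨CompEl.lift
      (fun _ m n => (CompEl.mk (M := M) (N := N) m.1 n.1, CompEl.mk (M := M') (N := N') m.2 n.2))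
      (fun _ _ g m n => Prod.ext (CompEl.sound (M := M) (N := N) g.1 m.1 n.1)
        (CompEl.sound (M := M') (N := N') g.2 m.2 n.2)),
    fun f => CompEl.ind fun _ m n => rfl,
    fun g => CompEl.ind fun _ m n => rfl⟩
  xInv M M' N N' := ⟨fun k => CompEl.lift (fun d m n => CompEl.lift (fun d' m' n' =>
          CompEl.mk (M := prod M M') (N := prod N N') (d := (d, d')) (m, m') (n, n'))
        (fun d₁ d₂ g m' n' => by
          have := CompEl.sound (M := prod M M') (N := prod N N')
            (show (d, d₁) ⟶ (d, d₂) from (𝟙 d, g)) (m, m') (n, n')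
          have e₁ : ract (prod M M') (show (d, d₁) ⟶ (d, d₂) from (𝟙 d, g)) (m, m') =
              (m, ract M' g m') := Prod.ext (ract_id M m) rfl
          have e₂ : lact (prod N N') (show (d, d₁) ⟶ (d, d₂) from (𝟙 d, g)) (n, n') =
              (n, lact N' g n') := Prod.ext (lact_id N n) rfl
          rw [e₁, e₂] at this
          exact this) k.2)
      (fun d₁ d₂ g m n => by
        generalize k.2 = k₂
        revert k₂
        refine CompEl.ind fun d' m' n' => ?_
        have := CompEl.sound (M := prod M M') (N := prod N N')
          (show (d₁, d') ⟶ (d₂, d') from (g, 𝟙 d')) (m, m') (n, n')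
        have e₁ : ract (prod M M') (show (d₁, d') ⟶ (d₂, d') from (g, 𝟙 d')) (m, m') =
            (ract M g m, m') := Prod.ext rfl (ract_id M' m')
        have e₂ : lact (prod N N') (show (d₁, d') ⟶ (d₂, d') from (g, 𝟙 d')) (n, n') =
            (lact N g n, n') := Prod.ext rfl (lact_id N' n')
        rw [e₁, e₂] at this
        exact this) k.1,
    fun f ⟨k₁, k₂⟩ => by
      revert k₁ k₂
      exact CompEl.ind fun _ m n => CompEl.ind fun _ m' n' => rfl,
    fun g ⟨k₁, k₂⟩ => by
      revert k₁ k₂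
      exact CompEl.ind fun _ m n => CompEl.ind fun _ m' n' => rfl⟩
  u A B := ⟨fun m => m, fun f m => rfl, fun g m => rfl⟩
  uInv A B := ⟨fun m => m, fun f m => rfl, fun g m => rfl⟩

instance : MonoidalDoubleCategory.{w, w + 1} Cat.{w, w} where
  tSq_vid M M' := Square.sqEq rfl rfl fun _ _ _ => HEq.rfl
  tSq_vcomp σ τ σ' τ' := Square.sqEq rfl rfl fun _ _ _ => HEq.rfl
  ta_natural σ σ' σ'' := Square.sqEq rfl rfl fun _ _ _ => HEq.rfl
  ta_taInv M N P := Square.sqEq rfl rfl fun _ _ _ => HEq.rfl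
  taInv_ta M N P := Square.sqEq rfl rfl fun _ _ _ => HEq.rfl
  tl_natural σ := Square.sqEq rfl rfl fun _ _ _ => HEq.rfl
  tl_tlInv M := Square.sqEq rfl rfl fun _ _ _ => HEq.rfl
  tlInv_tl M := Square.sqEq rfl rfl fun _ _ _ => HEq.rfl
  tr_natural σ := Square.sqEq rfl rfl fun _ _ _ => HEq.rfl
  tr_trInv M := Square.sqEq rfl rfl fun _ _ _ => HEq.rfl
  trInv_tr M := Square.sqEq rfl rfl fun _ _ _ => HEq.rfl
  t_triangle M N := Square.sqEq rfl rfl fun _ _ _ => HEq.rfl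
  t_pentagon M N P Q := Square.sqEq rfl rfl fun _ _ _ => HEq.rfl
  x_natural σ σ' τ τ' := by
    refine Square.sqEq rfl rfl fun c d k => heq_of_eq ?_
    induction k using ind with | h _ m n => rfl
  x_xInv M M' N N' := by
    refine Square.sqEq rfl rfl fun c d k => heq_of_eq ?_
    induction k using ind with | h _ m n => rfl
  xInv_x M M' N N' := by
    refine Square.sqEq rfl rfl fun c d k => heq_of_eq ?_
    obtain ⟨k, k'⟩ := k
    revert k k'
    exact CompEl.ind fun _ m n => CompEl.ind fun _ m' n' => rfl
  u_natural F G := Square.sqEq rfl rfl fun _ _ _ => HEq.rfl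
  u_uInv A B := Square.sqEq rfl rfl fun _ _ _ => HEq.rfl
  uInv_u A B := Square.sqEq rfl rfl fun _ _ _ => HEq.rfl
  x_assoc M₁ N₁ M₂ N₂ M₃ N₃ := by
    refine Square.sqEq rfl rfl fun c d k => heq_of_eq ?_
    induction k using ind with
    | h _ k p => induction k using ind with
      | h _ m n => rfl
  x_right M N := by
    refine Square.sqEq rfl rfl fun c d k => heq_of_eq ?_
    induction k using ind with | h _ m n => rfl
  x_left M N := by
    refine Square.sqEq rfl rfl fun c d k => heq_of_eq ?_
    induction k using ind with | h _ m n => rfl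
  ta_hcomp M₁ N₁ P₁ M₂ N₂ P₂ := by
    refine Square.sqEq rfl rfl fun c d k => heq_of_eq ?_
    induction k using ind with | h _ m n => rfl
  ta_unit A B C := Square.sqEq rfl rfl fun _ _ _ => HEq.rfl
  tr_hcomp M N := by
    refine Square.sqEq rfl rfl fun c d k => heq_of_eq ?_
    induction k using ind with | h _ m n => rfl
  tr_unit A := Square.sqEq rfl rfl fun _ _ _ => HEq.rfl
  tl_hcomp M N := by
    refine Square.sqEq rfl rfl fun c d k => heq_of_eq ?_
    induction k using ind with | h _ m n => rfl
  tl_unit A := Square.sqEq rfl rfl fun _ _ _ => HEq.rfl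

/-- The vertical 2-cell given by a natural transformation. -/
def vcell {A B : Cat.{w, w}} {F G : A ⟶ B} (θ : F.toFunctor ⟶ G.toFunctor) : VCell F G :=
  Square.mk (fun {c d} (m : c ⟶ d) => (F.toFunctor.map m ≫ θ.app d : _ ⟶ _))
    (fun f m => by
      refine (congrArg (· ≫ _) (F.toFunctor.map_comp f m)).trans ?_
      exact Category.assoc _ _ _)
    (fun g m => by
      refine (congrArg (· ≫ _) (F.toFunctor.map_comp m g)).trans ?_
      refine (Category.assoc _ _ _).trans ?_
      refine (congrArg (_ ≫ ·) (θ.naturality g)).trans ?_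
      exact (Category.assoc _ _ _).symm)

/-- The invertible vertical 2-cell given by a natural isomorphism. -/
def viso {A B : Cat.{w, w}} {F G : A ⟶ B} (e : F.toFunctor ≅ G.toFunctor) : VIso F G where
  hom := vcell e.hom
  inv := vcell e.inv
  hom_inv := by
    refine Square.eq fun c d m => ?_
    change (F.toFunctor.map (𝟙 c) ≫ e.hom.app c) ≫ (G.toFunctor.map m ≫ e.inv.app d) =
      F.toFunctor.map m
    have h : ∀ m : c ⟶ d, F.toFunctor.map m ≫ e.hom.app d = e.hom.app c ≫ G.toFunctor.map m :=
      fun m => e.hom.naturality m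
    rw [CategoryTheory.Functor.map_id, Category.id_comp, ← Category.assoc, ← h m, Category.assoc]
    simp
  inv_hom := by
    refine Square.eq fun c d m => ?_
    change (G.toFunctor.map (𝟙 c) ≫ e.inv.app c) ≫ (F.toFunctor.map m ≫ e.hom.app d) =
      G.toFunctor.map m
    have h : ∀ m : c ⟶ d, G.toFunctor.map m ≫ e.inv.app d = e.inv.app c ≫ F.toFunctor.map m :=
      fun m => e.inv.naturality m
    rw [CategoryTheory.Functor.map_id, Category.id_comp, ← Category.assoc, ← h m, Category.assoc]
    simp

/-- The map of a vertical 2-cell of categories, as a map of hom-sets. -/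
def vapp {A B : Cat.{w, w}} {F G : A ⟶ B} (θ : VCell F G) {c d : A} (m : c ⟶ d) :
    F.toFunctor.obj c ⟶ G.toFunctor.obj d :=
  Square.app θ m

theorem vtrans_app {A B : Cat.{w, w}} {F G G' K : A ⟶ B} (e : G = G') (θ : VCell F G)
    (θ' : VCell G' K) {c d : A} (m : c ⟶ d) :
    Square.app (vtrans e θ θ') m =
      vapp θ (𝟙 c) ≫ eqToHom (congrArg (fun H : A ⟶ B => H.toFunctor.obj c) e) ≫ vapp θ' m := by
  subst e
  exact (congrArg (fun k => vapp θ (𝟙 c) ≫ k) (Category.id_comp (vapp θ' m))).symm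

theorem vtrans_vtrans_app {A B : Cat.{w, w}} {F G G' K K' L : A ⟶ B} (e : G = G') (e' : K = K')
    (θ : VCell F G) (θ' : VCell G' K) (θ'' : VCell K' L) {c d : A} (m : c ⟶ d) :
    Square.app (vtrans e' (vtrans e θ θ') θ'') m =
      (vapp θ (𝟙 c) ≫ eqToHom (congrArg (fun H : A ⟶ B => H.toFunctor.obj c) e) ≫
        vapp θ' (𝟙 c)) ≫ eqToHom (congrArg (fun H : A ⟶ B => H.toFunctor.obj c) e') ≫
          vapp θ'' m :=
  (vtrans_app e' _ θ'' m).trans (congrArg (fun k => k ≫ _) (vtrans_app e θ θ' (𝟙 c)))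

end Prof

/-! ## The double category of wiring diagrams -/

/-- A box with a set of inputs and a set of outputs. -/
structure Box : Type (u + 1) where
  inp : Type u
  out : Type u

namespace Box

/-- A wiring diagram `φ : (A, B) ⟶ (C, D)`, with `φ^in : C × B → A` and `φ^out : B → D`. -/
@[ext]
structure Wiring (X Y : Box.{u}) : Type u where
  win : Y.inp × X.out → X.inp
  wout : X.out → Y.out

instance : Category Box.{u} where
  Hom := Wiring
  id X := ⟨fun p => p.1, fun b => b⟩
  comp φ ψ := ⟨fun p => φ.win (ψ.win (p.1, φ.wout p.2), p.2), fun b => ψ.wout (φ.wout b)⟩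

instance : MonoidalCategory Box.{u} where
  tensorObj X Y := ⟨X.inp × Y.inp, X.out × Y.out⟩
  tensorUnit := ⟨PUnit, PUnit⟩
  tensorHom φ ψ := ⟨fun p => (φ.win (p.1.1, p.2.1), ψ.win (p.1.2, p.2.2)),
    fun b => (φ.wout b.1, ψ.wout b.2)⟩
  whiskerLeft X _ _ ψ := ⟨fun p => (p.1.1, ψ.win (p.1.2, p.2.2)), fun b => (b.1, ψ.wout b.2)⟩
  whiskerRight φ X := ⟨fun p => (φ.win (p.1.1, p.2.1), p.1.2), fun b => (φ.wout b.1, b.2)⟩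
  associator X Y Z :=
    { hom := ⟨fun p => ((p.1.1, p.1.2.1), p.1.2.2), fun b => (b.1.1, (b.1.2, b.2))⟩
      inv := ⟨fun p => (p.1.1.1, (p.1.1.2, p.1.2)), fun b => ((b.1, b.2.1), b.2.2)⟩
      hom_inv_id := rfl
      inv_hom_id := rfl }
  leftUnitor X :=
    { hom := ⟨fun p => (PUnit.unit, p.1), fun b => b.2⟩
      inv := ⟨fun p => p.1.2, fun b => (PUnit.unit, b)⟩
      hom_inv_id := rfl
      inv_hom_id := rfl }
  rightUnitor X :=
    { hom := ⟨fun p => (p.1, PUnit.unit), fun b => b.1⟩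
      inv := ⟨fun p => p.1.1, fun b => (b, PUnit.unit)⟩
      hom_inv_id := rfl
      inv_hom_id := rfl }
  tensorHom_def _ _ := rfl
  id_tensorHom_id _ _ := rfl
  tensorHom_comp_tensorHom _ _ _ _ := rfl
  whiskerLeft_id _ _ := rfl
  id_whiskerRight _ _ := rfl
  associator_naturality _ _ _ := rfl
  leftUnitor_naturality _ := rfl
  rightUnitor_naturality _ := rfl
  pentagon _ _ _ _ := rfl
  triangle _ _ := rfl

open DoubleCat DoubleData

/-- A horizontal arrow of boxes: a map of inputs and a map of outputs. -/
structure Arrow (X Y : Box.{u}) : Type u where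
  fst : X.inp → Y.inp
  snd : X.out → Y.out

/-- A square of boxes: the two diagrams commute. -/
structure Square {X Y X' Y' : Box.{u}} (φ : X ⟶ X') (ψ : Y ⟶ Y') (M : Arrow X Y)
    (N : Arrow X' Y') : Type where
  out_comm : ∀ b : X.out, ψ.wout (M.snd b) = N.snd (φ.wout b)
  in_comm : ∀ (c : X'.inp) (b : X.out), ψ.win (N.fst c, M.snd b) = M.fst (φ.win (c, b))


theorem Square.eq {X Y X' Y' : Box.{u}} {φ : X ⟶ X'} {ψ : Y ⟶ Y'} {M : Arrow X Y}
    {N : Arrow X' Y'} (σ τ : Square φ ψ M N) : σ = τ := by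
  cases σ
  cases τ
  rfl

instance : DoubleData.{0, u} Box.{u} where
  Hor := Arrow
  Sq := Square
  vid M := ⟨fun _ => rfl, fun _ _ => rfl⟩
  vcomp {X Y X' Y' X'' Y'' φ ψ φ' ψ' M N P} σ τ :=
    ⟨fun b => (congrArg ψ'.wout (σ.out_comm b)).trans (τ.out_comm (φ.wout b)),
     fun c b => by
      change ψ.win (ψ'.win (P.fst c, ψ.wout (M.snd b)), M.snd b) =
        M.fst (φ.win (φ'.win (c, φ.wout b), b))
      rw [σ.out_comm, τ.in_comm, σ.in_comm]⟩
  U X := ⟨id, id⟩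
  Usq φ := ⟨fun _ => rfl, fun _ _ => rfl⟩
  hcomp M N := ⟨N.fst ∘ M.fst, N.snd ∘ M.snd⟩
  hsq {X Y Z X' Y' Z' φ ψ θ M N M' N'} σ τ :=
    ⟨fun b => (τ.out_comm (M.snd b)).trans (congrArg N'.snd (σ.out_comm b)),
     fun c b => (τ.in_comm (M'.fst c) (M.snd b)).trans (congrArg N.fst (σ.in_comm c b))⟩
  a M N P := ⟨fun _ => rfl, fun _ _ => rfl⟩
  aInv M N P := ⟨fun _ => rfl, fun _ _ => rfl⟩
  l M := ⟨fun _ => rfl, fun _ _ => rfl⟩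
  lInv M := ⟨fun _ => rfl, fun _ _ => rfl⟩
  r M := ⟨fun _ => rfl, fun _ _ => rfl⟩
  rInv M := ⟨fun _ => rfl, fun _ _ => rfl⟩

theorem Square.sqEq {X Y X' Y' : Box.{u}} {φ φ' : X ⟶ X'} {ψ ψ' : Y ⟶ Y'} {M : Hor X Y}
    {N : Hor X' Y'} {σ : Sq φ ψ M N} {τ : Sq φ' ψ' M N} (h : φ = φ') (h' : ψ = ψ') : σ ≡ₛ τ := by
  subst h h'
  exact ⟨rfl, rfl, heq_of_eq (Square.eq σ τ)⟩

instance : DoubleCategory.{0, u} Box.{u} where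
  vid_vcomp _ := Square.sqEq rfl rfl
  vcomp_vid _ := Square.sqEq rfl rfl
  vcomp_assoc _ _ _ := Square.sqEq rfl rfl
  Usq_id _ := rfl
  Usq_comp _ _ := rfl
  hsq_vid _ _ := rfl
  hsq_vcomp _ _ _ _ := rfl
  a_natural _ _ _ := Square.sqEq rfl rfl
  a_aInv _ _ _ := Square.sqEq rfl rfl
  aInv_a _ _ _ := Square.sqEq rfl rfl
  l_natural _ := Square.sqEq rfl rfl
  l_lInv _ := Square.sqEq rfl rfl
  lInv_l _ := Square.sqEq rfl rfl
  r_natural _ := Square.sqEq rfl rfl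
  r_rInv _ := Square.sqEq rfl rfl
  rInv_r _ := Square.sqEq rfl rfl
  triangle _ _ := Square.sqEq rfl rfl
  pentagon _ _ _ _ := Square.sqEq rfl rfl

instance : MonoidalDoubleData.{0, u} Box.{u} where
  tHor M N := ⟨Prod.map M.fst N.fst, Prod.map M.snd N.snd⟩
  tSq σ τ := ⟨fun b => Prod.ext (σ.out_comm b.1) (τ.out_comm b.2),
    fun c b => Prod.ext (σ.in_comm c.1 b.1) (τ.in_comm c.2 b.2)⟩
  ta M N P := ⟨fun _ => rfl, fun _ _ => rfl⟩
  taInv M N P := ⟨fun _ => rfl, fun _ _ => rfl⟩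
  tl M := ⟨fun _ => rfl, fun _ _ => rfl⟩
  tlInv M := ⟨fun _ => rfl, fun _ _ => rfl⟩
  tr M := ⟨fun _ => rfl, fun _ _ => rfl⟩
  trInv M := ⟨fun _ => rfl, fun _ _ => rfl⟩
  x M M' N N' := ⟨fun _ => rfl, fun _ _ => rfl⟩
  xInv M M' N N' := ⟨fun _ => rfl, fun _ _ => rfl⟩
  u X Y := ⟨fun _ => rfl, fun _ _ => rfl⟩
  uInv X Y := ⟨fun _ => rfl, fun _ _ => rfl⟩

instance : MonoidalDoubleCategory.{0, u} Box.{u} where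
  tSq_vid _ _ := Square.sqEq rfl rfl
  tSq_vcomp _ _ _ _ := Square.sqEq rfl rfl
  ta_natural _ _ _ := Square.sqEq rfl rfl
  ta_taInv _ _ _ := Square.sqEq rfl rfl
  taInv_ta _ _ _ := Square.sqEq rfl rfl
  tl_natural _ := Square.sqEq rfl rfl
  tl_tlInv _ := Square.sqEq rfl rfl
  tlInv_tl _ := Square.sqEq rfl rfl
  tr_natural _ := Square.sqEq rfl rfl
  tr_trInv _ := Square.sqEq rfl rfl
  trInv_tr _ := Square.sqEq rfl rfl
  t_triangle _ _ := Square.sqEq rfl rfl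
  t_pentagon _ _ _ _ := Square.sqEq rfl rfl
  x_natural _ _ _ _ := Square.sqEq rfl rfl
  x_xInv _ _ _ _ := Square.sqEq rfl rfl
  xInv_x _ _ _ _ := Square.sqEq rfl rfl
  u_natural _ _ := Square.sqEq rfl rfl
  u_uInv _ _ := Square.sqEq rfl rfl
  uInv_u _ _ := Square.sqEq rfl rfl
  x_assoc _ _ _ _ _ _ := Square.sqEq rfl rfl
  x_right _ _ := Square.sqEq rfl rfl
  x_left _ _ := Square.sqEq rfl rfl
  ta_hcomp _ _ _ _ _ _ := Square.sqEq rfl rfl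
  ta_unit _ _ _ := Square.sqEq rfl rfl
  tr_hcomp _ _ := Square.sqEq rfl rfl
  tr_unit _ := Square.sqEq rfl rfl
  tl_hcomp _ _ := Square.sqEq rfl rfl
  tl_unit _ := Square.sqEq rfl rfl

end Box

/-! ## Continuous systems -/

open DoubleCat DoubleData MonoidalDoubleData

/-- A continuous dynamical system on a box: a real vector space `S` of states, an update function
`A × S → S` and a readout function `S → B`. -/
structure ContSys (X : Box.{u}) : Type (u + 1) where
  S : Type u
  [addCommGroup : AddCommGroup S]
  [module : Module ℝ S]
  upd : X.inp × S → S
  rdt : S → X.out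

namespace ContSys

attribute [instance] ContSys.addCommGroup ContSys.module

/-- A morphism of continuous systems over a horizontal arrow `(f, g)` of boxes: a linear map `m`
that commutes with the updates over `f` and with the readouts over `g`. -/
@[ext]
structure Hom {X Y : Box.{u}} (M : Box.Arrow X Y) (P : ContSys X) (Q : ContSys Y) :
    Type (u + 1) where
  lin : P.S →ₗ[ℝ] Q.S
  upd_comm : ∀ (a : X.inp) (s : P.S), Q.upd (M.fst a, lin s) = lin (P.upd (a, s))
  rdt_comm : ∀ s : P.S, Q.rdt (lin s) = M.snd (P.rdt s)

/-- Composition of morphisms of systems. -/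
def Hom.comp {X Y Z : Box.{u}} {M : Box.Arrow X Y} {N : Box.Arrow Y Z} {P : ContSys X}
    {Q : ContSys Y} {R : ContSys Z} (m : Hom M P Q) (n : Hom N Q R) :
    Hom (M ⊙ N : Hor X Z) P R where
  lin := n.lin.comp m.lin
  upd_comm a s := (n.upd_comm (M.fst a) (m.lin s)).trans (congrArg n.lin (m.upd_comm a s))
  rdt_comm s := (n.rdt_comm (m.lin s)).trans (congrArg N.snd (m.rdt_comm s))

/-- The category `CS(A, B)`. -/
instance (X : Box.{u}) : Category.{u + 1} (ContSys X) where
  Hom := Hom (U X : Hor X X)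
  id P := ⟨LinearMap.id, fun _ _ => rfl, fun _ => rfl⟩
  comp m n := m.comp n

/-- An isomorphism of systems from a linear isomorphism. -/
def isoMk {X : Box.{u}} {P Q : ContSys X} (e : P.S ≃ₗ[ℝ] Q.S)
    (h₁ : ∀ (a : X.inp) (s : P.S), Q.upd (a, e s) = e (P.upd (a, s)))
    (h₂ : ∀ s : P.S, Q.rdt (e s) = P.rdt s) : P ≅ Q where
  hom := ⟨e, h₁, h₂⟩
  inv := ⟨e.symm, fun a s => by
      have := h₁ a (e.symm s)
      rw [e.apply_symm_apply] at this
      exact (e.symm_apply_eq.2 this).symm, fun s => by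
      have := h₂ (e.symm s)
      rw [e.apply_symm_apply] at this
      exact this.symm⟩
  hom_inv_id := Hom.ext (LinearMap.ext fun s => e.symm_apply_apply s)
  inv_hom_id := Hom.ext (LinearMap.ext fun s => e.apply_symm_apply s)

/-- A wiring diagram applied to a system. -/
def wire {X Y : Box.{u}} (φ : X ⟶ Y) (P : ContSys X) : ContSys Y where
  S := P.S
  upd p := P.upd (φ.win (p.1, P.rdt p.2), p.2)
  rdt s := φ.wout (P.rdt s)

/-- Squares of boxes applied to morphisms of systems. -/
def Hom.wire {X Y X' Y' : Box.{u}} {φ : X ⟶ X'} {ψ : Y ⟶ Y'} {M : Hor X Y} {N : Hor X' Y'}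
    (σ : Sq φ ψ M N) {P : ContSys X} {Q : ContSys Y} (m : Hom M P Q) :
    Hom N (P.wire φ) (Q.wire ψ) where
  lin := m.lin
  upd_comm := fun a (s : P.S) => by
    change Q.upd (ψ.win (N.fst a, Q.rdt (m.lin s)), m.lin s) =
      m.lin (P.upd (φ.win (a, P.rdt s), s))
    rw [m.rdt_comm, Box.Square.in_comm σ, m.upd_comm]
  rdt_comm := fun (s : P.S) => by
    change ψ.wout (Q.rdt (m.lin s)) = N.snd (φ.wout (P.rdt s))
    rw [m.rdt_comm, Box.Square.out_comm σ]

/-- The parallel product of two systems. -/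
def prod {X Y : Box.{u}} (P : ContSys X) (Q : ContSys Y) : ContSys (X ⊗ Y) where
  S := P.S × Q.S
  upd p := (P.upd (p.1.1, p.2.1), Q.upd (p.1.2, p.2.2))
  rdt s := (P.rdt s.1, Q.rdt s.2)

/-- The parallel product of morphisms of systems. -/
def Hom.prod {X Y X' Y' : Box.{u}} {M : Hor X Y} {M' : Hor X' Y'} {P : ContSys X} {Q : ContSys Y}
    {P' : ContSys X'} {Q' : ContSys Y'} (m : Hom M P Q) (m' : Hom M' P' Q') :
    Hom (M ⊠ M') (P.prod P') (Q.prod Q') where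
  lin := m.lin.prodMap m'.lin
  upd_comm a s := Prod.ext (m.upd_comm a.1 s.1) (m'.upd_comm a.2 s.2)
  rdt_comm s := Prod.ext (m.rdt_comm s.1) (m'.rdt_comm s.2)

/-- The trivial system. -/
def triv : ContSys (𝟙_ Box.{u}) where
  S := PUnit
  upd _ := PUnit.unit
  rdt _ := PUnit.unit

/-- The action of a wiring diagram as a functor. -/
def wireFunctor {X Y : Box.{u}} (φ : X ⟶ Y) : ContSys X ⥤ ContSys Y where
  obj P := P.wire φ
  map m := Hom.wire (Usq φ) m

/-- The profunctor of morphisms of systems over a horizontal arrow. -/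
def profunctor {X Y : Box.{u}} (M : Hor X Y) : Profunctor.{u + 1} (ContSys Y) (ContSys X) :=
  Prof.ofActions (fun P Q => Hom M P Q) (fun f m => Hom.comp (M := U X) f m)
    (fun g m => Hom.comp (N := U Y) m g) (fun _ => rfl) (fun _ => rfl) (fun _ _ _ => rfl)
    (fun _ _ _ => rfl) (fun _ _ _ => rfl)

/-- The lax double functor `CS`. -/
def lax : LaxDoubleFunctor Box.{u} Cat.{u + 1, u + 1} where
  F₀ :=
    { obj X := Cat.of (ContSys X)
      map φ := (wireFunctor φ).toCatHom }
  hor M := profunctor M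
  sq σ := Prof.Square.mk (fun m => Hom.wire σ m) (fun _ _ => rfl) (fun _ _ => rfl)
  sq_vid M := Prof.Square.sqEq rfl rfl fun _ _ _ => HEq.rfl
  sq_vcomp σ τ := Prof.Square.sqEq rfl rfl fun _ _ _ => HEq.rfl
  comp M N := Prof.Square.mk
    (Prof.CompEl.lift (fun _ m n => Hom.comp m n) (fun _ _ _ _ _ => rfl))
    (fun f => Prof.CompEl.ind fun _ m n => rfl) (fun g => Prof.CompEl.ind fun _ m n => rfl)
  comp_natural σ τ := by
    refine Prof.Square.sqEq rfl rfl fun c d k => heq_of_eq ?_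
    induction k using Prof.ind with | h _ m n => rfl
  unit X := Prof.Square.mk (fun m => m) (fun _ _ => rfl) (fun _ _ => rfl)
  unit_natural φ := Prof.Square.sqEq rfl rfl fun _ _ _ => HEq.rfl
  assoc M N P := by
    refine Prof.Square.sqEq rfl rfl fun c d k => heq_of_eq ?_
    induction k using Prof.ind with
    | h _ k p => induction k using Prof.ind with
      | h _ m n => rfl
  unit_left M := by
    refine Prof.Square.sqEq rfl rfl fun c d k => heq_of_eq ?_
    induction k using Prof.ind with | h _ m n => rfl
  unit_right M := by
    refine Prof.Square.sqEq rfl rfl fun c d k => heq_of_eq ?_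
    induction k using Prof.ind with | h _ m n => rfl

/-- The laxity of `CS`: the parallel product as a functor. -/
def prodFunctor (X Y : Box.{u}) : ContSys X × ContSys Y ⥤ ContSys (X ⊗ Y) where
  obj P := P.1.prod P.2
  map m := Hom.prod m.1 m.2

/-- The unit of `CS`: the trivial system. -/
def unitFunctor : 𝟙_ Cat.{u + 1, u + 1} ⟶ Cat.of (ContSys (𝟙_ Box.{u})) :=
  Cat.Hom.ofFunctor ((Functor.const (𝟙_ Cat.{u + 1, u + 1} : Cat.{u + 1, u + 1})).obj triv)

set_option maxHeartbeats 2000000 in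
/-- The lax monoidal double functor `CS`. -/
def CS : LaxMonoidalDoubleFunctor Box.{u} Cat.{u + 1, u + 1} where
  toLaxDoubleFunctor := lax
  μ X Y := (prodFunctor X Y).toCatHom
  μ_natural φ ψ := rfl
  ε := unitFunctor
  ν M M' := Prof.Square.mk (fun m => Hom.prod m.1 m.2) (fun _ _ => rfl) (fun _ _ => rfl)
  ν_natural σ σ' := Prof.Square.sqEq rfl rfl fun _ _ _ => HEq.rfl
  δ := Prof.Square.mk (fun _ => (𝟙 triv : triv ⟶ triv)) (fun _ _ => rfl) (fun _ _ => rfl)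
  assocCell X Y Z := Prof.viso (NatIso.ofComponents
    (fun P : (ContSys X × ContSys Y) × ContSys Z =>
      isoMk (P := ((P.1.1.prod P.1.2).prod P.2).wire (α_ X Y Z).hom)
        (Q := P.1.1.prod (P.1.2.prod P.2))
        (LinearEquiv.prodAssoc ℝ P.1.1.S P.1.2.S P.2.S) (fun _ _ => rfl) (fun _ => rfl))
    (fun m => rfl))
  assocCell_natural φ ψ θ := Prof.Square.sqEq rfl rfl fun _ _ _ => HEq.rfl
  assocCell_ν M N P := Prof.Square.sqEq rfl rfl fun _ _ _ => HEq.rfl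
  leftCell X := Prof.viso (NatIso.ofComponents
    (fun P : ((𝟙_ Cat.{u + 1, u + 1} : Cat.{u + 1, u + 1}) × ContSys X) =>
      isoMk (P := (triv.prod P.2).wire (λ_ X).hom) (Q := P.2)
        (LinearEquiv.uniqueProd (R := ℝ) (M₂ := PUnit.{u + 1}) (M := P.2.S)) (fun _ _ => rfl) (fun _ => rfl))
    (fun m => rfl))
  leftCell_natural φ := Prof.Square.sqEq rfl rfl fun _ _ _ => HEq.rfl
  leftCell_ν M := Prof.Square.sqEq rfl rfl fun _ _ _ => HEq.rfl
  rightCell X := Prof.viso (NatIso.ofComponents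
    (fun P : (ContSys X × (𝟙_ Cat.{u + 1, u + 1} : Cat.{u + 1, u + 1})) =>
      isoMk (P := (P.1.prod triv).wire (ρ_ X).hom) (Q := P.1)
        (LinearEquiv.prodUnique (R := ℝ) (M₂ := PUnit.{u + 1}) (M := P.1.S)) (fun _ _ => rfl) (fun _ => rfl))
    (fun m => rfl))
  rightCell_natural φ := Prof.Square.sqEq rfl rfl fun _ _ _ => HEq.rfl
  rightCell_ν M := Prof.Square.sqEq rfl rfl fun _ _ _ => HEq.rfl
  cell_pentagon X Y Z W := by
    refine Prof.Square.sqEq rfl rfl fun c d m => ?_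
    refine (heq_of_eq (Prof.vtrans_app _ _ _ m)).trans
      (HEq.trans ?_ (heq_of_eq (Prof.vtrans_vtrans_app _ _ _ _ _ m)).symm)
    exact HEq.rfl
  cell_triangle X Y := by
    refine Prof.Square.sqEq rfl rfl fun c d m => ?_
    exact (heq_of_eq (Prof.vtrans_app _ _ _ m)).trans HEq.rfl
  comp_tensor M M' N N' := by
    refine Prof.Square.sqEq rfl rfl fun c d k => heq_of_eq ?_
    induction k using Prof.ind with | h _ m n => rfl
  comp_tensorUnit := by
    refine Prof.Square.sqEq rfl rfl fun c d k => heq_of_eq ?_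
    induction k using Prof.ind with | h _ m n => rfl
  unit_tensor X Y := Prof.Square.sqEq rfl rfl fun _ _ _ => HEq.rfl
  unit_tensorUnit := Prof.Square.sqEq rfl rfl fun _ _ _ => HEq.rfl

end ContSys

/-! ## Four-step discrete systems -/

/-- A discrete dynamical system on a box: a set `S` of states, an update function `A × S → S` and
a readout function `S → B`. -/
structure DiscSys (X : Box.{u}) : Type (u + 1) where
  S : Type u
  upd : X.inp × S → S
  rdt : S → X.out

namespace DiscSys

/-- A morphism of discrete systems over a horizontal arrow `(f, g)` of boxes: a map `m` that
commutes with the updates over `f` and with the readouts over `g`. -/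
@[ext]
structure Hom {X Y : Box.{u}} (M : Box.Arrow X Y) (P : DiscSys X) (Q : DiscSys Y) :
    Type (u + 1) where
  fn : P.S → Q.S
  upd_comm : ∀ (a : X.inp) (s : P.S), Q.upd (M.fst a, fn s) = fn (P.upd (a, s))
  rdt_comm : ∀ s : P.S, Q.rdt (fn s) = M.snd (P.rdt s)

/-- Composition of morphisms of systems. -/
def Hom.comp {X Y Z : Box.{u}} {M : Box.Arrow X Y} {N : Box.Arrow Y Z} {P : DiscSys X}
    {Q : DiscSys Y} {R : DiscSys Z} (m : Hom M P Q) (n : Hom N Q R) :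
    Hom (M ⊙ N : Hor X Z) P R where
  fn s := n.fn (m.fn s)
  upd_comm a s := (n.upd_comm (M.fst a) (m.fn s)).trans (congrArg n.fn (m.upd_comm a s))
  rdt_comm s := (n.rdt_comm (m.fn s)).trans (congrArg N.snd (m.rdt_comm s))

/-- A wiring diagram applied to a system. -/
def wire {X Y : Box.{u}} (φ : X ⟶ Y) (P : DiscSys X) : DiscSys Y where
  S := P.S
  upd p := P.upd (φ.win (p.1, P.rdt p.2), p.2)
  rdt s := φ.wout (P.rdt s)

/-- Squares of boxes applied to morphisms of systems. -/
def Hom.wire {X Y X' Y' : Box.{u}} {φ : X ⟶ X'} {ψ : Y ⟶ Y'} {M : Hor X Y} {N : Hor X' Y'}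
    (σ : Sq φ ψ M N) {P : DiscSys X} {Q : DiscSys Y} (m : Hom M P Q) :
    Hom N (P.wire φ) (Q.wire ψ) where
  fn := m.fn
  upd_comm := fun a (s : P.S) => by
    change Q.upd (ψ.win (N.fst a, Q.rdt (m.fn s)), m.fn s) =
      m.fn (P.upd (φ.win (a, P.rdt s), s))
    rw [m.rdt_comm, Box.Square.in_comm σ, m.upd_comm]
  rdt_comm := fun (s : P.S) => by
    change ψ.wout (Q.rdt (m.fn s)) = N.snd (φ.wout (P.rdt s))
    rw [m.rdt_comm, Box.Square.out_comm σ]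

/-- The cyclic system `C₄`: four states that are iterated through cyclically. -/
def C₄ : DiscSys (𝟙_ Box.{u}) where
  S := ULift (ZMod 4)
  upd p := ⟨p.2.down + 1⟩
  rdt _ := PUnit.unit

end DiscSys

/-- The unique horizontal arrow to the one-point box. -/
def Box.toUnit (X : Box.{u}) : Box.Arrow X (𝟙_ Box.{u}) := ⟨fun _ => PUnit.unit, fun _ => PUnit.unit⟩

/-- A four-step system: a discrete system with a morphism to `C₄`. -/
structure FourSys (X : Box.{u}) : Type (u + 1) where
  sys : DiscSys X
  phase : DiscSys.Hom X.toUnit sys DiscSys.C₄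

namespace FourSys

/-- The states of a four-step system. -/
abbrev S {X : Box.{u}} (P : FourSys X) : Type u := P.sys.S

/-- A morphism of four-step systems over a horizontal arrow of boxes: a morphism of discrete
systems over `C₄`. -/
@[ext]
structure Hom {X Y : Box.{u}} (M : Box.Arrow X Y) (P : FourSys X) (Q : FourSys Y) :
    Type (u + 1) where
  hom : DiscSys.Hom M P.sys Q.sys
  phase_comm : ∀ s : P.S, Q.phase.fn (hom.fn s) = P.phase.fn s

theorem Hom.ext_fn {X Y : Box.{u}} {M : Box.Arrow X Y} {P : FourSys X} {Q : FourSys Y}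
    {m n : Hom M P Q} (h : ∀ s : P.S, m.hom.fn s = n.hom.fn s) : m = n :=
  Hom.ext (DiscSys.Hom.ext (funext h))

/-- Composition of morphisms of four-step systems. -/
def Hom.comp {X Y Z : Box.{u}} {M : Box.Arrow X Y} {N : Box.Arrow Y Z} {P : FourSys X}
    {Q : FourSys Y} {R : FourSys Z} (m : Hom M P Q) (n : Hom N Q R) :
    Hom (M ⊙ N : Hor X Z) P R where
  hom := m.hom.comp n.hom
  phase_comm s := (n.phase_comm (m.hom.fn s)).trans (m.phase_comm s)

/-- The category `(DS/C₄)(A, B)`. -/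
instance (X : Box.{u}) : Category.{u + 1} (FourSys X) where
  Hom := Hom (U X : Hor X X)
  id P := ⟨⟨fun s => s, fun _ _ => rfl, fun _ => rfl⟩, fun _ => rfl⟩
  comp m n := m.comp n

/-- An isomorphism of four-step systems from a bijection. -/
def isoMk {X : Box.{u}} {P Q : FourSys X} (e : P.S ≃ Q.S)
    (h₁ : ∀ (a : X.inp) (s : P.S), Q.sys.upd (a, e s) = e (P.sys.upd (a, s)))
    (h₂ : ∀ s : P.S, Q.sys.rdt (e s) = P.sys.rdt s)
    (h₃ : ∀ s : P.S, Q.phase.fn (e s) = P.phase.fn s) : P ≅ Q where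
  hom := ⟨⟨e, h₁, h₂⟩, h₃⟩
  inv := ⟨⟨e.symm, fun a s => by
      have := h₁ a (e.symm s)
      rw [e.apply_symm_apply] at this
      exact (e.symm_apply_eq.2 this).symm, fun s => by
      have := h₂ (e.symm s)
      rw [e.apply_symm_apply] at this
      exact this.symm⟩, fun s => by
      have := h₃ (e.symm s)
      rw [e.apply_symm_apply] at this
      exact this.symm⟩
  hom_inv_id := Hom.ext_fn fun s => e.symm_apply_apply s
  inv_hom_id := Hom.ext_fn fun s => e.apply_symm_apply s

/-- A wiring diagram applied to a four-step system. -/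
def wire {X Y : Box.{u}} (φ : X ⟶ Y) (P : FourSys X) : FourSys Y where
  sys := P.sys.wire φ
  phase := ⟨P.phase.fn, fun _ s => P.phase.upd_comm _ s, fun _ => rfl⟩

/-- Squares of boxes applied to morphisms of four-step systems. -/
def Hom.wire {X Y X' Y' : Box.{u}} {φ : X ⟶ X'} {ψ : Y ⟶ Y'} {M : Hor X Y} {N : Hor X' Y'}
    (σ : Sq φ ψ M N) {P : FourSys X} {Q : FourSys Y} (m : Hom M P Q) :
    Hom N (P.wire φ) (Q.wire ψ) where
  hom := DiscSys.Hom.wire σ m.hom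
  phase_comm s := m.phase_comm s

/-- The parallel product of two four-step systems, which is the product over `C₄`: its states are
the pairs of states that are in the same step. -/
def prod {X Y : Box.{u}} (P : FourSys X) (Q : FourSys Y) : FourSys (X ⊗ Y) where
  sys :=
    { S := {s : P.S × Q.S // P.phase.fn s.1 = Q.phase.fn s.2}
      upd p := ⟨(P.sys.upd (p.1.1, p.2.1.1), Q.sys.upd (p.1.2, p.2.1.2)), by
        refine (P.phase.upd_comm _ _).symm.trans (Eq.trans ?_ (Q.phase.upd_comm _ _))
        exact congrArg (fun i => DiscSys.C₄.upd (PUnit.unit, i)) p.2.2⟩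
      rdt s := (P.sys.rdt s.1.1, Q.sys.rdt s.1.2) }
  phase := ⟨fun s => P.phase.fn s.1.1, fun a s => P.phase.upd_comm a.1 s.1.1, fun _ => rfl⟩

/-- The parallel product of morphisms of four-step systems. -/
def Hom.prod {X Y X' Y' : Box.{u}} {M : Hor X Y} {M' : Hor X' Y'} {P : FourSys X} {Q : FourSys Y}
    {P' : FourSys X'} {Q' : FourSys Y'} (m : Hom M P Q) (m' : Hom M' P' Q') :
    Hom (M ⊠ M') (P.prod P') (Q.prod Q') where
  hom :=
    { fn s := ⟨(m.hom.fn s.1.1, m'.hom.fn s.1.2), by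
        rw [m.phase_comm, m'.phase_comm]
        exact s.2⟩
      upd_comm a s := Subtype.ext
        (Prod.ext (m.hom.upd_comm a.1 s.1.1) (m'.hom.upd_comm a.2 s.1.2))
      rdt_comm s := Prod.ext (m.hom.rdt_comm s.1.1) (m'.hom.rdt_comm s.1.2) }
  phase_comm s := m.phase_comm s.1.1

/-- The unit for the parallel product over `C₄`: the system `C₄` itself. -/
def triv : FourSys (𝟙_ Box.{u}) where
  sys := DiscSys.C₄
  phase := ⟨fun i => i, fun _ _ => rfl, fun _ => rfl⟩

/-- The action of a wiring diagram as a functor. -/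
def wireFunctor {X Y : Box.{u}} (φ : X ⟶ Y) : FourSys X ⥤ FourSys Y where
  obj P := P.wire φ
  map m := Hom.wire (Usq φ) m

/-- The profunctor of morphisms of four-step systems over a horizontal arrow. -/
def profunctor {X Y : Box.{u}} (M : Hor X Y) : Profunctor.{u + 1} (FourSys Y) (FourSys X) :=
  Prof.ofActions (fun P Q => Hom M P Q) (fun f m => Hom.comp (M := U X) f m)
    (fun g m => Hom.comp (N := U Y) m g) (fun _ => rfl) (fun _ => rfl) (fun _ _ _ => rfl)
    (fun _ _ _ => rfl) (fun _ _ _ => rfl)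

/-- The lax double functor `DS/C₄`. -/
def lax : LaxDoubleFunctor Box.{u} Cat.{u + 1, u + 1} where
  F₀ :=
    { obj X := Cat.of (FourSys X)
      map φ := (wireFunctor φ).toCatHom }
  hor M := profunctor M
  sq σ := Prof.Square.mk (fun m => Hom.wire σ m) (fun _ _ => rfl) (fun _ _ => rfl)
  sq_vid M := Prof.Square.sqEq rfl rfl fun _ _ _ => HEq.rfl
  sq_vcomp σ τ := Prof.Square.sqEq rfl rfl fun _ _ _ => HEq.rfl
  comp M N := Prof.Square.mk
    (Prof.CompEl.lift (fun _ m n => Hom.comp m n) (fun _ _ _ _ _ => rfl))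
    (fun f => Prof.CompEl.ind fun _ m n => rfl) (fun g => Prof.CompEl.ind fun _ m n => rfl)
  comp_natural σ τ := by
    refine Prof.Square.sqEq rfl rfl fun c d k => heq_of_eq ?_
    induction k using Prof.ind with | h _ m n => rfl
  unit X := Prof.Square.mk (fun m => m) (fun _ _ => rfl) (fun _ _ => rfl)
  unit_natural φ := Prof.Square.sqEq rfl rfl fun _ _ _ => HEq.rfl
  assoc M N P := by
    refine Prof.Square.sqEq rfl rfl fun c d k => heq_of_eq ?_
    induction k using Prof.ind with
    | h _ k p => induction k using Prof.ind with
      | h _ m n => rfl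
  unit_left M := by
    refine Prof.Square.sqEq rfl rfl fun c d k => heq_of_eq ?_
    induction k using Prof.ind with | h _ m n => rfl
  unit_right M := by
    refine Prof.Square.sqEq rfl rfl fun c d k => heq_of_eq ?_
    induction k using Prof.ind with | h _ m n => rfl

/-- The laxity of `DS/C₄`: the parallel product as a functor. -/
def prodFunctor (X Y : Box.{u}) : FourSys X × FourSys Y ⥤ FourSys (X ⊗ Y) where
  obj P := P.1.prod P.2
  map m := Hom.prod m.1 m.2

/-- The unit of `DS/C₄`: the system `C₄`. -/
def unitFunctor : 𝟙_ Cat.{u + 1, u + 1} ⟶ Cat.of (FourSys (𝟙_ Box.{u})) :=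
  Cat.Hom.ofFunctor ((Functor.const (𝟙_ Cat.{u + 1, u + 1} : Cat.{u + 1, u + 1})).obj triv)

set_option maxHeartbeats 2000000 in
/-- The lax monoidal double functor `DS/C₄`. -/
def DSC₄ : LaxMonoidalDoubleFunctor Box.{u} Cat.{u + 1, u + 1} where
  toLaxDoubleFunctor := lax
  μ X Y := (prodFunctor X Y).toCatHom
  μ_natural φ ψ := rfl
  ε := unitFunctor
  ν M M' := Prof.Square.mk (fun m => Hom.prod m.1 m.2) (fun _ _ => rfl) (fun _ _ => rfl)
  ν_natural σ σ' := Prof.Square.sqEq rfl rfl fun _ _ _ => HEq.rfl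
  δ := Prof.Square.mk (fun _ => (𝟙 triv : triv ⟶ triv)) (fun _ _ => rfl) (fun _ _ => rfl)
  assocCell X Y Z := Prof.viso (NatIso.ofComponents
    (fun P : (FourSys X × FourSys Y) × FourSys Z =>
      isoMk (P := ((P.1.1.prod P.1.2).prod P.2).wire (α_ X Y Z).hom)
        (Q := P.1.1.prod (P.1.2.prod P.2))
        { toFun s := ⟨(s.1.1.1.1, ⟨(s.1.1.1.2, s.1.2), s.1.1.2.symm.trans s.2⟩), s.1.1.2⟩
          invFun s := ⟨(⟨(s.1.1, s.1.2.1.1), s.2⟩, s.1.2.1.2), s.2.trans s.1.2.2⟩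
          left_inv _ := rfl
          right_inv _ := rfl } (fun _ _ => rfl) (fun _ => rfl) (fun _ => rfl))
    (fun m => rfl))
  assocCell_natural φ ψ θ := Prof.Square.sqEq rfl rfl fun _ _ _ => HEq.rfl
  assocCell_ν M N P := Prof.Square.sqEq rfl rfl fun _ _ _ => HEq.rfl
  leftCell X := Prof.viso (NatIso.ofComponents
    (fun P : ((𝟙_ Cat.{u + 1, u + 1} : Cat.{u + 1, u + 1}) × FourSys X) =>
      isoMk (P := (triv.prod P.2).wire (λ_ X).hom) (Q := P.2)
        { toFun s := s.1.2
          invFun s := ⟨(P.2.phase.fn s, s), rfl⟩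
          left_inv s := Subtype.ext (Prod.ext s.2.symm rfl)
          right_inv _ := rfl } (fun _ _ => rfl) (fun _ => rfl) (fun s => s.2.symm))
    (fun m => rfl))
  leftCell_natural φ := Prof.Square.sqEq rfl rfl fun _ _ _ => HEq.rfl
  leftCell_ν M := Prof.Square.sqEq rfl rfl fun _ _ _ => HEq.rfl
  rightCell X := Prof.viso (NatIso.ofComponents
    (fun P : (FourSys X × (𝟙_ Cat.{u + 1, u + 1} : Cat.{u + 1, u + 1})) =>
      isoMk (P := (P.1.prod triv).wire (ρ_ X).hom) (Q := P.1)
        { toFun s := s.1.1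
          invFun s := ⟨(s, P.1.phase.fn s), rfl⟩
          left_inv s := Subtype.ext (Prod.ext rfl s.2)
          right_inv _ := rfl } (fun _ _ => rfl) (fun _ => rfl) (fun _ => rfl))
    (fun m => rfl))
  rightCell_natural φ := Prof.Square.sqEq rfl rfl fun _ _ _ => HEq.rfl
  rightCell_ν M := Prof.Square.sqEq rfl rfl fun _ _ _ => HEq.rfl
  cell_pentagon X Y Z W := by
    refine Prof.Square.sqEq rfl rfl fun c d m => ?_
    refine (heq_of_eq (Prof.vtrans_app _ _ _ m)).trans
      (HEq.trans ?_ (heq_of_eq (Prof.vtrans_vtrans_app _ _ _ _ _ m)).symm)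
    exact HEq.rfl
  cell_triangle X Y := by
    refine Prof.Square.sqEq rfl rfl fun c d m => ?_
    exact (heq_of_eq (Prof.vtrans_app _ _ _ m)).trans HEq.rfl
  comp_tensor M M' N N' := by
    refine Prof.Square.sqEq rfl rfl fun c d k => heq_of_eq ?_
    induction k using Prof.ind with | h _ m n => rfl
  comp_tensorUnit := by
    refine Prof.Square.sqEq rfl rfl fun c d k => heq_of_eq ?_
    induction k using Prof.ind with | h _ m n => rfl
  unit_tensor X Y := Prof.Square.sqEq rfl rfl fun _ _ _ => HEq.rfl
  unit_tensorUnit := Prof.Square.sqEq rfl rfl fun _ _ _ => HEq.rfl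

end FourSys

/-! ## The Runge–Kutta method -/

namespace RungeKutta

/-- The state set `S ⊔ S² ⊔ S³ ⊔ S⁴` of the Runge–Kutta method: the current point together with
the slopes that have been computed so far. -/
inductive State (S : Type u) : Type u
  | one (s : S)
  | two (s k₁ : S)
  | three (s k₁ k₂ : S)
  | four (s k₁ k₂ k₃ : S)

namespace State

/-- The map `m ⊔ m² ⊔ m³ ⊔ m⁴`. -/
def map {S T : Type u} (m : S → T) : State S → State T
  | one s => one (m s)
  | two s k₁ => two (m s) (m k₁)
  | three s k₁ k₂ => three (m s) (m k₁) (m k₂)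
  | four s k₁ k₂ k₃ => four (m s) (m k₁) (m k₂) (m k₃)

/-- The step that a state is in, as a state of `C₄`. -/
def step {S : Type u} : State S → ZMod 4
  | one _ => 0
  | two _ _ => 1
  | three _ _ _ => 2
  | four _ _ _ _ => 3

/-- The point at which the system is read and its slope is evaluated. -/
noncomputable def point {S : Type u} [AddCommGroup S] [Module ℝ S] (h : ℝ) : State S → S
  | one s => s
  | two s k₁ => s + (h / 2) • k₁
  | three s _ k₂ => s + (h / 2) • k₂
  | four s _ _ k₃ => s + h • k₃

/-- The next state, given the slope `k` at the current point. -/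
noncomputable def next {S : Type u} [AddCommGroup S] [Module ℝ S] (h : ℝ) : State S → S → State S
  | one s, k => two s k
  | two s k₁, k => three s k₁ k
  | three s k₁ k₂, k => four s k₁ k₂ k
  | four s k₁ k₂ k₃, k =>
    one (s + (h / 6) • k₁ + (h / 3) • k₂ + (h / 3) • k₃ + (h / 6) • k)

end State

/-- The four-step system of the Runge–Kutta method with step size `h` for a continuous system
with update `f` and readout `g`. The update on input `a` is
* `s ↦ (s, f (a, s))`,
* `(s, k₁) ↦ (s, k₁, f (a, s + (h / 2) • k₁))`,
* `(s, k₁, k₂) ↦ (s, k₁, k₂, f (a, s + (h / 2) • k₂))`,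
* `(s, k₁, k₂, k₃) ↦
    s + (h / 6) • k₁ + (h / 3) • k₂ + (h / 3) • k₃ + (h / 6) • f (a, s + h • k₃)`,

and the readout is `g` at the point at which the slope is evaluated. -/
noncomputable def system (h : ℝ) {X : Box.{u}} (P : ContSys X) : FourSys X where
  sys :=
    { S := State P.S
      upd p := p.2.next h (P.upd (p.1, p.2.point h))
      rdt s := P.rdt (s.point h) }
  phase := ⟨fun s => ⟨s.step⟩, fun _ s => by cases s <;> rfl, fun _ => rfl⟩

theorem map_point (h : ℝ) {S T : Type u} [AddCommGroup S] [Module ℝ S] [AddCommGroup T]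
    [Module ℝ T] (m : S →ₗ[ℝ] T) (s : State S) : (s.map m).point h = m (s.point h) := by
  cases s <;> simp [State.map, State.point]

theorem map_next (h : ℝ) {S T : Type u} [AddCommGroup S] [Module ℝ S] [AddCommGroup T]
    [Module ℝ T] (m : S →ₗ[ℝ] T) (s : State S) (k : S) :
    (s.map m).next h (m k) = (s.next h k).map m := by
  cases s <;> simp [State.map, State.next]

/-- The Runge–Kutta method on morphisms of systems: a linear map `m` is sent to
`m ⊔ m² ⊔ m³ ⊔ m⁴`. -/
noncomputable def hom (h : ℝ) {X Y : Box.{u}} {M : Box.Arrow X Y} {P : ContSys X} {Q : ContSys Y}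
    (m : ContSys.Hom M P Q) : FourSys.Hom M (system h P) (system h Q) where
  hom :=
    { fn := State.map m.lin
      upd_comm := fun a (s : State P.S) => by
        change (s.map m.lin).next h (Q.upd (M.fst a, (s.map m.lin).point h)) =
          (s.next h (P.upd (a, s.point h))).map m.lin
        rw [map_point, m.upd_comm, map_next]
      rdt_comm := fun (s : State P.S) => by
        change Q.rdt ((s.map m.lin).point h) = M.snd (P.rdt (s.point h))
        rw [map_point, m.rdt_comm] }
  phase_comm := fun (s : State P.S) => by cases s <;> rfl

theorem State.map_map {S T R : Type u} (m : S → T) (n : T → R) (s : State S) :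
    s.map (fun x => n (m x)) = (s.map m).map n := by
  cases s <;> rfl

theorem State.map_id {S : Type u} (s : State S) : s.map (fun x => x) = s := by
  cases s <;> rfl

/-- The functor `RK_h(A, B) : CS(A, B) ⥤ (DS/C₄)(A, B)`. -/
noncomputable def functor (h : ℝ) (X : Box.{u}) : ContSys X ⥤ FourSys X where
  obj P := system h P
  map m := hom h m
  map_id P := FourSys.Hom.ext_fn fun s => State.map_id s
  map_comp m n := FourSys.Hom.ext_fn fun s => State.map_map m.lin n.lin s

theorem hom_comp (h : ℝ) {X Y Z : Box.{u}} {M : Hor X Y} {N : Hor Y Z} {P : ContSys X}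
    {Q : ContSys Y} {R : ContSys Z} (m : ContSys.Hom M P Q) (n : ContSys.Hom N Q R) :
    hom h (m.comp n) = (hom h m).comp (hom h n) :=
  FourSys.Hom.ext_fn fun s => State.map_map m.lin n.lin s

/-- The Runge–Kutta method on the profunctors of morphisms of systems. -/
noncomputable def square (h : ℝ) {X Y : Box.{u}} (M : Hor X Y) :
    Sq (D := Cat.{u + 1, u + 1}) (functor h X).toCatHom (functor h Y).toCatHom
      (ContSys.profunctor M) (FourSys.profunctor M) :=
  Prof.Square.mk (fun {P Q} (m : ContSys.Hom M P Q) => hom h m)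
    (fun f m => hom_comp h (M := U X) f m) (fun g m => hom_comp h (N := U Y) m g)

/-- The comparison between the Runge–Kutta method for a parallel product of systems and the
parallel product of the Runge–Kutta methods: the bijections `(S × T)ⁿ ≃ Sⁿ × Tⁿ`. -/
noncomputable def prodIso (h : ℝ) {X Y : Box.{u}} (P : ContSys X) (Q : ContSys Y) :
    system h (P.prod Q) ≅ (system h P).prod (system h Q) :=
  FourSys.isoMk (P := system h (P.prod Q)) (Q := (system h P).prod (system h Q))
    { toFun := fun (s : State (P.S × Q.S)) =>
        ⟨(s.map Prod.fst, s.map Prod.snd), by cases s <;> rfl⟩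
      invFun s := match s with
        | ⟨(.one s, .one t), _⟩ => State.one (s, t)
        | ⟨(.two s k₁, .two t l₁), _⟩ => State.two (s, t) (k₁, l₁)
        | ⟨(.three s k₁ k₂, .three t l₁ l₂), _⟩ => State.three (s, t) (k₁, l₁) (k₂, l₂)
        | ⟨(.four s k₁ k₂ k₃, .four t l₁ l₂ l₃), _⟩ =>
          State.four (s, t) (k₁, l₁) (k₂, l₂) (k₃, l₃)
      left_inv s := by cases s <;> rfl
      right_inv s := by
        rcases s with ⟨⟨s | _ | _ | _, t | _ | _ | _⟩, e⟩ <;> first | rfl | cases e }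
    (fun _ s => by cases s <;> rfl) (fun s => by cases s <;> rfl) (fun s => by cases s <;> rfl)

/-- The comparison `prodIso` as a vertical 2-cell. -/
noncomputable def prodCell (h : ℝ) (X Y : Box.{u}) :
    VCell (D := Cat.{u + 1, u + 1})
      ((ContSys.prodFunctor X Y).toCatHom ≫ (functor h (X ⊗ Y)).toCatHom)
      (((functor h X).toCatHom ⊗ₘ (functor h Y).toCatHom) ≫ (FourSys.prodFunctor X Y).toCatHom) :=
  Prof.vcell
    { app := fun (P : ContSys X × ContSys Y) => (prodIso h P.1 P.2).hom
      naturality := fun _ _ _ => FourSys.Hom.ext_fn fun s => by cases s <;> rfl }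

/-- The comparison between the Runge–Kutta method for the trivial system and `C₄`: the bijection
`1 ⊔ 1² ⊔ 1³ ⊔ 1⁴ ≃ {1, 2, 3, 4}`. -/
noncomputable def unitIso (h : ℝ) : system h ContSys.triv.{u} ≅ FourSys.triv :=
  FourSys.isoMk (P := system h ContSys.triv) (Q := FourSys.triv)
    { toFun := fun (s : State PUnit) => ⟨s.step⟩
      invFun := fun (i : ULift (ZMod 4)) =>
        if i.down = 0 then State.one ⟨⟩ else if i.down = 1 then State.two ⟨⟩ ⟨⟩
          else if i.down = 2 then State.three ⟨⟩ ⟨⟩ ⟨⟩ else State.four ⟨⟩ ⟨⟩ ⟨⟩ ⟨⟩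
      left_inv s := by cases s <;> rfl
      right_inv := by
        rintro ⟨i⟩
        fin_cases i <;> rfl }
    (fun _ s => by cases s <;> rfl) (fun s => by cases s <;> rfl) (fun s => by cases s <;> rfl)

/-- The comparison `unitIso` as a vertical 2-cell. -/
noncomputable def unitCell (h : ℝ) :
    VCell (D := Cat.{u + 1, u + 1})
      (ContSys.unitFunctor ≫ (functor h (𝟙_ Box.{u})).toCatHom) FourSys.unitFunctor :=
  Prof.vcell
    { app := fun _ => (unitIso h).hom
      naturality := fun _ _ _ => FourSys.Hom.ext_fn fun s => by cases s <;> rfl }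

end RungeKutta

/-! The Runge–Kutta method only uses the states, update and readout of a system through the vector
space operations on states and through evaluation of the system at the current `State.point`.

* Linear maps commute with `State.point` and `State.next`, so `m ↦ m ⊔ m² ⊔ m³ ⊔ m⁴` carries
  morphisms of continuous systems to morphisms of four-step systems, functorially.
* A wiring diagram feeds the readout back into the input. The readout of the four-step system at
  a state is the readout of the continuous system at exactly the point at which the slope is
  evaluated there, so wiring before and after applying the method gives definitionally the same
  system. Hence naturality in wiring diagrams and squares holds on the nose.
* `State` is a coproduct of powers, and powers commute with products; matching the summands is
  what the product over `C₄` does. This gives `prodIso` and `unitIso`, and the coherence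
  conditions compare two maps out of some `State S` that agree on each of the four summands.

In all conditions on squares of profunctors the two sides are compared on elements; the coherence
conditions, whose vertical composites are formed along equalities of functors, are evaluated with
`Prof.vtrans_vtrans_app`, where the resulting `eqToHom` is an identity by computation. -/

namespace RungeKutta

/-- The functors `RK_h(A, B)` as a natural transformation in wiring diagrams. Naturality is
definitional because the readout and the slope are evaluated at the same point. -/
noncomputable def natTrans (h : ℝ) : ContSys.CS.{u}.F₀ ⟶ FourSys.DSC₄.{u}.F₀ where
  app X := (functor h X).toCatHom
  naturality _ _ _ := rfl

theorem square_natural (h : ℝ) {X Y X' Y' : Box.{u}} {φ : X ⟶ X'} {ψ : Y ⟶ Y'} {M : Hor X Y}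
    {N : Hor X' Y'} (σ : Sq φ ψ M N) :
    ContSys.CS.sq σ ≫ᵥ square h N ≡ₛ square h M ≫ᵥ FourSys.DSC₄.sq σ :=
  Prof.Square.sqEq rfl rfl fun _ _ _ => HEq.rfl

/-- Compatibility with the comparisons for horizontal composition. It suffices to check it on
representatives of the coend, where it says that `m ↦ m ⊔ m² ⊔ m³ ⊔ m⁴` preserves composition. -/
theorem square_comp (h : ℝ) {X Y Z : Box.{u}} (M : Hor X Y) (N : Hor Y Z) :
    ContSys.CS.comp M N ≫ᵥ square h (M ⊙ N) ≡ₛ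
      (square h M ⊙ₛ square h N) ≫ᵥ FourSys.DSC₄.comp M N := by
  refine Prof.Square.sqEq rfl rfl fun _ _ k => heq_of_eq ?_
  induction k using Prof.ind with | h _ m n => exact hom_comp h m n

theorem square_unit (h : ℝ) (X : Box.{u}) :
    ContSys.CS.unit X ≫ᵥ square h (U X) ≡ₛ Usq (functor h X).toCatHom ≫ᵥ FourSys.DSC₄.unit X :=
  Prof.Square.sqEq rfl rfl fun _ _ _ => HEq.rfl

/-- The Runge–Kutta method as a double transformation, without its monoidal structure. -/
noncomputable def doubleTransformation (h : ℝ) :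
    DoubleTransformation ContSys.CS.{u}.toLaxDoubleFunctor FourSys.DSC₄.{u}.toLaxDoubleFunctor where
  α₀ := natTrans h
  α₁ M := square h M
  natural σ := square_natural h σ
  comp M N := square_comp h M N
  unit X := square_unit h X

/-- The isomorphisms `prodIso`, natural in the two systems, as an invertible vertical 2-cell with
underlying 2-cell `prodCell`. -/
noncomputable def prodVIso (h : ℝ) (X Y : Box.{u}) :
    VIso (D := Cat.{u + 1, u + 1})
      ((ContSys.prodFunctor X Y).toCatHom ≫ (functor h (X ⊗ Y)).toCatHom)
      (((functor h X).toCatHom ⊗ₘ (functor h Y).toCatHom) ≫ (FourSys.prodFunctor X Y).toCatHom) :=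
  Prof.viso (NatIso.ofComponents (fun P : ContSys X × ContSys Y => prodIso h P.1 P.2)
    (fun _ => FourSys.Hom.ext_fn fun s => by cases s <;> rfl))

/-- The isomorphism `unitIso` as an invertible vertical 2-cell with underlying 2-cell
`unitCell`. -/
noncomputable def unitVIso (h : ℝ) :
    VIso (D := Cat.{u + 1, u + 1})
      (ContSys.unitFunctor ≫ (functor h (𝟙_ Box.{u})).toCatHom) FourSys.unitFunctor :=
  Prof.viso (NatIso.ofComponents (fun _ => unitIso h)
    (fun _ => FourSys.Hom.ext_fn fun s => by cases s <;> rfl))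

theorem prodVIso_natural (h : ℝ) {X Y X' Y' : Box.{u}} (φ : X ⟶ X') (ψ : Y ⟶ Y') :
    Usq (ContSys.CS.F₀.map φ ⊗ₘ ContSys.CS.F₀.map ψ) ≫ᵥ (prodVIso h X' Y').hom ≡ₛ
      (prodVIso h X Y).hom ≫ᵥ Usq (FourSys.DSC₄.F₀.map (φ ⊗ₘ ψ)) := by
  refine Prof.Square.sqEq rfl rfl fun _ _ _ => heq_of_eq ?_
  exact FourSys.Hom.ext_fn fun s => by cases s <;> rfl

theorem prodVIso_square (h : ℝ) {X Y X' Y' : Box.{u}} (M : Hor X X') (N : Hor Y Y') :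
    Intertwines (prodVIso h X Y).hom (prodVIso h X' Y').hom
      (ContSys.CS.ν M N ≫ᵥ square h (M ⊠ N)) ((square h M ⊠ₛ square h N) ≫ᵥ FourSys.DSC₄.ν M N) := by
  refine Prof.Square.sqEq rfl rfl fun _ _ _ => heq_of_eq ?_
  exact FourSys.Hom.ext_fn fun s => by cases s <;> rfl

theorem unitVIso_square (h : ℝ) :
    Intertwines (unitVIso.{u} h).hom (unitVIso h).hom (ContSys.CS.δ ≫ᵥ square h (U (𝟙_ Box.{u})))
      FourSys.DSC₄.δ := by
  refine Prof.Square.sqEq rfl rfl fun _ _ _ => heq_of_eq ?_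
  exact FourSys.Hom.ext_fn fun s => by cases s <;> rfl

/-- The Runge–Kutta method as a monoidal double transformation `CS ⟹ DS/C₄`. -/
noncomputable def transformation (h : ℝ) :
    MonoidalDoubleTransformation ContSys.CS.{u} FourSys.DSC₄.{u} where
  toDoubleTransformation := doubleTransformation h
  tensorCell X Y := prodVIso h X Y
  tensorCell_natural φ ψ := prodVIso_natural h φ ψ
  tensorCell_ν M N := prodVIso_square h M N
  unitCell := unitVIso h
  unitCell_δ := unitVIso_square h
  cell_assoc X Y Z := by
    refine Prof.Square.sqEq rfl rfl fun c d m => ?_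
    refine (heq_of_eq (Prof.vtrans_vtrans_app _ _ _ _ _ m)).trans
      (HEq.trans ?_ (heq_of_eq (Prof.vtrans_vtrans_app _ _ _ _ _ m)).symm)
    -- The endpoints of the two composites are definitionally equal, so the heterogeneous equality
    -- is one between morphisms out of the same four-step system.
    refine heq_of_eq ?_
    exact FourSys.Hom.ext_fn fun s => by cases s <;> rfl
  cell_left X := by
    refine Prof.Square.sqEq rfl rfl fun c d m => heq_of_eq ?_
    refine (Prof.vtrans_vtrans_app _ _ _ _ _ m).trans ?_
    exact FourSys.Hom.ext_fn fun s => by cases s <;> rfl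
  cell_right X := by
    refine Prof.Square.sqEq rfl rfl fun c d m => heq_of_eq ?_
    refine (Prof.vtrans_vtrans_app _ _ _ _ _ m).trans ?_
    exact FourSys.Hom.ext_fn fun s => by cases s <;> rfl

end RungeKutta

theorem theorem1 (h : ℝ) :
    ∃ RK : DoubleCat.MonoidalDoubleTransformation ContSys.CS.{u} FourSys.DSC₄.{u},
      (∀ X : Box.{u}, RK.α₀.app X = (RungeKutta.functor h X).toCatHom) ∧
      (∀ (X Y : Box.{u}) (M : DoubleCat.DoubleData.Hor X Y), RK.α₁ M ≡ₛ RungeKutta.square h M) ∧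
      (∀ X Y : Box.{u}, (RK.tensorCell X Y).hom ≡ₛ RungeKutta.prodCell h X Y) ∧
      RK.unitCell.hom ≡ₛ RungeKutta.unitCell h :=
  ⟨RungeKutta.transformation h, fun _ => rfl, fun _ _ _ => ⟨rfl, rfl, HEq.rfl⟩,
    fun _ _ => ⟨rfl, rfl, HEq.rfl⟩, rfl, rfl, HEq.rfl⟩
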